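/- Let $K$ be a field of characteristic $0$ and let all functions of the times $t=(t_1=x,t_2,t_3,\dots)$ be represented by their formal power series expansions around a base point $c=(c_1,c_2,\dots)$ with finitely many non-zero entries; write $\partial=\partial/\partial x$. Let $L^{(0)}=\partial+q\,\partial^{-1}r=W\partial W^{-1}$, $W=1+\sum_{j\ge1}w_j\partial^{-j}$, be a solution of the constrained KP hierarchy with one component: with $B_n=((L^{(0)})^n)_+$, for all $n\ge 1$, $\partial L^{(0)}/\partial t_n=[B_n,L^{(0)}]$, $\partial q/\partial t_n=B_n(q)$, $\partial r/\partial t_n=-B_n^*(r)$, $\partial W/\partial t_n=-((L^{(0)})^n)_-W$; and let $\tau^{(0)}$ be an invertible tau function of it, i.e. if $W(e^{\xi})=w\,e^{\xi}$ and $W^{*-1}(e^{-\xi})=w^*e^{-\xi}$ with $\xi=\sum_n t_n\lambda^n$, then $w=\tau^{(0)}(t-[\lambda^{-1}])/\tau^{(0)}(t)$ and $w^*=\tau^{(0)}(t+[\lambda^{-1}])/\tau^{(0)}(t)$, where $[\lambda^{-1}]=(\lambda^{-1},\tfrac12\lambda^{-2},\dots)$. Let $M=W\big(\sum_{l\ge1}l\,t_l\,\partial^{l-1}\big)W^{-1}$,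 and suppose that the solution is invariant under the lowest additional symmetry flow $\partial_0^*$, that is, $$\partial_0^*L^{(0)}=[-M_-,L^{(0)}]=0,\qquad \partial_0^*r=-(M_+)^*(r)=0 .$$ Put $q^{(0)}=q$, $r^{(0)}=r$ and, successively, $q^{(k+1)}=1/r^{(k)}$, $r^{(k+1)}=-\big(T_D(r^{(k)})L^{(k)*}\big)(r^{(k)})$, $\tau^{(k+1)}=r^{(k)}\tau^{(k)}$, where $L^{(k)}=\partial+q^{(k)}\partial^{-1}r^{(k)}$ and $T_D(\chi)=\chi\,\partial\,\chi^{-1}$. Let $n\ge0$ and suppose that $r^{(0)},\dots,r^{(n-1)}$ are invertible. Then: 1. $L^{(k+1)}=T_I(r^{(k)})\,L^{(k)}\,T_I(r^{(k)})^{-1}$ with $T_I(\mu)=\mu^{-1}\partial^{-1}\mu$, for $0\le k<n$; that is, $L^{(n)}$ is obtained by $n$ successive integral type gauge transformations. 2. The tau function $\tau^{(n)}$ satisfies the string-equation constraint $$\Big(-\sum_{l\ge1}(l+1)t_{l+1}\frac{\partial}{\partial t_l}+n x\Big)\frac{\tau^{(n)}}{\tau^{(0)}}=0 .$$ 3. $\tau^{(n)}=W_n\big[(L^{(0)*})^{n-1}(r),\dots,L^{(0)*}(r),r\big]\,\tau^{(0)}$,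 where $W_n$ is the Wronskian determinant in $x$, and $$\Big(-\sum_{l\ge1}(l+1)t_{l+1}\frac{\partial}{\partial t_l}+n x\Big)W_n\big[(L^{(0)*})^{n-1}(r),\dots,L^{(0)*}(r),r\big]=0 ,$$ for every choice of the antiderivatives in $L^{(0)*}(f)=-f_x-r\int q f\,dx$. -/

import Mathlib

noncomputable section

namespace CKP

/-! ### Functions of the times

The functions of the times `t = (t₁ = x, t₂, t₃, …)` are represented by their expansions in powers
of `t - c` around a base point `c` with finitely many non-zero entries: the variable `X l` of the
power series ring is `t_l - c_l`. -/

/-- Formal power series in `t₁ - c₁, t₂ - c₂, …`. -/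
abbrev Fn (K : Type*) := MvPowerSeries ℕ+ K

variable {K : Type*} [Field K]

/-- The coordinate function `t_l = c_l + (t_l - c_l)`; in particular `time c 1` is `x`. -/
def time (c : ℕ+ →₀ K) (l : ℕ+) : Fn K := MvPowerSeries.C (c l) + MvPowerSeries.X l

/-- The derivation `∂/∂t_l`. -/
def pd (l : ℕ+) (f : Fn K) : Fn K := MvPowerSeries.pderiv K l f

/-- The sum of a family of power series, coefficient by coefficient (each coefficient of every
family summed below receives only finitely many non-zero contributions). -/
def csum {ι : Type*} (f : ι → Fn K) : Fn K := fun α => ∑ᶠ i, MvPowerSeries.coeff α (f i)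

/-- The operator `∑_{l ≥ 1} (l + 1) t_{l+1} ∂/∂t_l`. -/
def stringD (c : ℕ+ →₀ K) (f : Fn K) : Fn K :=
  csum fun l : ℕ+ => ((l : ℕ) + 1 : Fn K) * time c (l + 1) * pd l f

/-! ### Pseudo-differential operators -/

/-- Formal symbols `∑_{i ∈ ℤ} a_i ∂^i`, with `∂ = ∂/∂x = ∂/∂t₁`. Pseudo-differential operators of
finite order have `a_i = 0` for `i` large; the Orlov-Schulman operator has infinite order, with
coefficients `a_i` that tend to `0` in the power series ring as `i → ∞`. -/
@[ext] structure PDO (K : Type*) [Field K] where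
  /-- The coefficient of `∂^i`. -/
  coeff : ℤ → Fn K

namespace PDO

/-- The operator of multiplication by `f`. -/
def ofFn (f : Fn K) : PDO K := ⟨fun i => if i = 0 then f else 0⟩

/-- The operator `∂^i`, for `i ∈ ℤ`. -/
def dpow (i : ℤ) : PDO K := ⟨fun j => if j = i then 1 else 0⟩

instance : One (PDO K) := ⟨ofFn 1⟩
instance : Add (PDO K) := ⟨fun a b => ⟨fun i => a.coeff i + b.coeff i⟩⟩
instance : Neg (PDO K) := ⟨fun a => ⟨fun i => -a.coeff i⟩⟩
instance : Sub (PDO K) := ⟨fun a b => ⟨fun i => a.coeff i - b.coeff i⟩⟩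

/-- The operator product, from `∂^i f = ∑_{k ≥ 0} (i choose k) f^{(k)} ∂^{i-k}` for `i ∈ ℤ`. -/
instance : Mul (PDO K) :=
  ⟨fun a b => ⟨fun m => csum fun p : ℤ × ℕ =>
    Ring.choose p.1 p.2 • (a.coeff p.1 * (pd 1)^[p.2] (b.coeff (m - p.1 + p.2)))⟩⟩

/-- The power `a^n`. -/
def opPow (a : PDO K) : ℕ → PDO K
  | 0 => 1
  | n + 1 => opPow a n * a

/-- The differential part `(a)_+`. -/
def pos (a : PDO K) : PDO K := ⟨fun i => if 0 ≤ i then a.coeff i else 0⟩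

/-- The integral part `(a)_-`. -/
def neg (a : PDO K) : PDO K := ⟨fun i => if i < 0 then a.coeff i else 0⟩

/-- The commutator `[a, b]`. -/
def comm (a b : PDO K) : PDO K := a * b - b * a

/-- The conjugate `a^* = ∑_i (-∂)^i a_i`, expanded by the Leibniz rule. -/
def adj (a : PDO K) : PDO K :=
  ⟨fun m => csum fun k : ℕ =>
    (((m + k).negOnePow : ℤ) * Ring.choose (m + k) k) • (pd 1)^[k] (a.coeff (m + k))⟩

/-- The action `a(f) = ∑_{i ≥ 0} a_i f^{(i)}` of a differential operator `a` on a function `f`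
(it is used only for operators `a` with `(a)_- = 0`). -/
def act (a : PDO K) (f : Fn K) : Fn K := csum fun i : ℕ => a.coeff i * (pd 1)^[i] f

/-- Coefficientwise derivative `∂a/∂t_l`. -/
def tderiv (l : ℕ+) (a : PDO K) : PDO K := ⟨fun i => pd l (a.coeff i)⟩

/-- `a = 1 + ∑_{j ≥ 1} a_j ∂^{-j}`. -/
def IsMonicZero (a : PDO K) : Prop := a.coeff 0 = 1 ∧ ∀ i : ℤ, 0 < i → a.coeff i = 0

end PDO

open PDO

/-! ### The constrained KP hierarchy with one pair of (adjoint) eigenfunctions -/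

/-- The Lax operator `L = ∂ + q ∂^{-1} r`. -/
def lax (q r : Fn K) : PDO K := dpow 1 + ofFn q * dpow (-1) * ofFn r

/-- `B_n = (L^n)_+`. -/
def laxB (q r : Fn K) (n : ℕ+) : PDO K := (opPow (lax q r) n).pos

/-- The coefficient of `λ^{-j}` in `τ(t + ε[λ^{-1}])`, `[λ^{-1}] = (λ^{-1}, λ^{-2}/2, …)`, that is in
`exp(ε ∑_{l ≥ 1} (λ^{-l}/l) ∂/∂t_l) τ`; the recursion is
`(j + 1) S_{j+1} = ε ∑_{l=1}^{j+1} ∂S_{j+1-l}/∂t_l`, obtained by differentiating in `λ^{-1}`. -/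
def shiftCoeff (ε : K) (τ : Fn K) : ℕ → Fn K
  | 0 => τ
  | j + 1 => MvPowerSeries.C (ε / (j + 1 : K)) *
      ∑ l : Fin (j + 1), pd (Nat.succPNat l) (shiftCoeff ε τ (j - l))
  termination_by j => j
  decreasing_by omega

/-- `τ` is a tau function of the dressing operator `W` (with inverse `V`): with
`W(e^ξ) = w e^ξ` and `W^{*-1}(e^{-ξ}) = w^* e^{-ξ}`, where `ξ = ∑ t_n λ^n`, one has
`w = τ(t - [λ^{-1}])/τ(t)` and `w^* = τ(t + [λ^{-1}])/τ(t)`. -/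
def IsTau (W V : PDO K) (τ : Fn K) : Prop :=
  IsUnit τ ∧ ∀ j : ℕ,
    W.coeff (-j) * τ = shiftCoeff (-1) τ j ∧
    (-1 : Fn K) ^ j * V.adj.coeff (-j) * τ = shiftCoeff 1 τ j

/-- A solution of the constrained KP hierarchy: `L = ∂ + q ∂^{-1} r` satisfies the Lax equations,
`q` and `r` are an eigenfunction and an adjoint eigenfunction, `W` is a dressing operator of `L`
(with inverse `V = W^{-1}`), and `τ` is a tau function. -/
structure IsSolution (q r : Fn K) (W V : PDO K) (τ : Fn K) : Prop where
  lax_eq : ∀ n : ℕ+, (lax q r).tderiv n = comm (laxB q r n) (lax q r)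
  eigen : ∀ n : ℕ+, pd n q = (laxB q r n).act q
  adjoint_eigen : ∀ n : ℕ+, pd n r = -(laxB q r n).adj.act r
  monic : W.IsMonicZero
  monic_inv : V.IsMonicZero
  mul_inv : W * V = 1
  inv_mul : V * W = 1
  dressing : lax q r = W * dpow 1 * V
  sato : ∀ n : ℕ+, W.tderiv n = -((opPow (lax q r) n).neg * W)
  tau : IsTau W V τ

/-! ### The lowest additional symmetry flow -/

/-- The Orlov-Schulman operator `M = W (∑_{l ≥ 1} l t_l ∂^{l-1}) W^{-1}`. -/
def orlovSchulman (c : ℕ+ →₀ K) (W V : PDO K) : PDO K :=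
  ⟨fun i => csum fun l : ℕ+ =>
    (W * (ofFn (((l : ℕ) : Fn K) * time c l) * dpow ((l : ℤ) - 1)) * V).coeff i⟩

/-- `∂_0^* L = [-M_-, L]`: the flow `∂_k^* L = [-(M L^k)_- + X_{k-1}, L]` at `k = 0`, where the sum
that defines `X_{-1}` is empty. -/
def addFlowLax (c : ℕ+ →₀ K) (W V : PDO K) (q r : Fn K) : PDO K :=
  comm (-(orlovSchulman c W V).neg) (lax q r)

/-- `∂_0^* r = -(M_+)^*(r)`: the flow
`∂_k^* r = -((M L^k)_+)^*(r) + (k/2) (L^*)^{k-1}(r) - (X_{k-1})^*(r)` at `k = 0`. -/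
def addFlowAdj (c : ℕ+ →₀ K) (W V : PDO K) (r : Fn K) : Fn K :=
  -(orlovSchulman c W V).pos.adj.act r

/-! ### Integral type gauge transformations -/

/-- `T_D(χ) = χ ∂ χ^{-1}`. -/
def gaugeD (χ : Fn K) : PDO K := ofFn χ * dpow 1 * ofFn χ⁻¹

/-- `T_I(μ) = μ^{-1} ∂^{-1} μ`. -/
def gaugeI (μ : Fn K) : PDO K := ofFn μ⁻¹ * dpow (-1) * ofFn μ

/-- `T_I(μ)^{-1} = μ^{-1} ∂ μ`. -/
def gaugeIInv (μ : Fn K) : PDO K := ofFn μ⁻¹ * dpow 1 * ofFn μ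

/-- The fields `(q^{(k)}, r^{(k)})` after `k` successive integral type gauge transformations:
`q^{(k+1)} = 1/r^{(k)}` and `r^{(k+1)} = -(T_D(r^{(k)}) L^{(k)*})(r^{(k)})`. -/
def gaugeQR (q r : Fn K) : ℕ → Fn K × Fn K
  | 0 => (q, r)
  | k + 1 => ((gaugeQR q r k).2⁻¹,
      -(gaugeD (gaugeQR q r k).2 *
          (lax (gaugeQR q r k).1 (gaugeQR q r k).2).adj).act (gaugeQR q r k).2)

/-- The Lax operator `L^{(k)} = ∂ + q^{(k)} ∂^{-1} r^{(k)}`. -/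
def gaugeLax (q r : Fn K) (k : ℕ) : PDO K := lax (gaugeQR q r k).1 (gaugeQR q r k).2

/-- The adjoint eigenfunction `r^{(k)}`. -/
def gaugeR (q r : Fn K) (k : ℕ) : Fn K := (gaugeQR q r k).2

/-- The tau functions: `τ^{(k+1)} = r^{(k)} τ^{(k)}`. -/
def gaugeTau (q r τ : Fn K) : ℕ → Fn K
  | 0 => τ
  | k + 1 => gaugeR q r k * gaugeTau q r τ k

/-- `g` is a value of `L^*(f)`, where `L^* = -∂ - r ∂^{-1} q`, that is `g = -f_x - r ∫ q f dx` for
some choice of the antiderivative (which may depend on `t₂, t₃, …` through its integration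
constant). -/
def IsLaxAdjValue (q r f g : Fn K) : Prop :=
  ∃ φ : Fn K, pd 1 φ = q * f ∧ g = -pd 1 f - r * φ

/-- The Wronskian `W_n[f_0, …, f_{n-1}]` in the variable `x`. -/
def wronskian {n : ℕ} (f : Fin n → Fn K) : Fn K :=
  (Matrix.of fun i j : Fin n => (pd 1)^[(i : ℕ)] (f j)).det

end CKP

end

noncomputable section

namespace CKP

variable {K : Type*} [Field K]

/-! ### Partial derivatives -/

/-! Write `S` for the string operator `stringD c`. It is a derivation, and it commutes with `∂_x`
because its coefficients involve only `t_2, t_3, …`. Everything follows from the weight relations `S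
r = x r` and `S q = -x q`.

Dressing `t_{l+1}` gives `t_{l+1} L^l`, since `t_{l+1}` commutes with `W`; dressing `x` gives `x` up
to order `-2`. Hence `M_+ = x + ∑ (l+1) t_{l+1} B_l` and `res M = ∑ (l+1) t_{l+1} res L^l`. Since
`r` is an adjoint eigenfunction, `(M_+)^*(r) = 0` reads `S r = x r` (`stringD_right`). The `∂^{-1}`
coefficient of `[M_-, L] = 0` says that `res M` is independent of `x`, while the Lax equation gives
`∂(qr)/∂t_l = ∂_x res L^l`; so `S(qr) = 0` (`stringD_mul_eq_zero`), and dividing by `r` gives `S q =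
-x q`.

A gauge step sends `(q, r)` to `(1/r, r_xx - r_x²/r + q r²)` and preserves both weights
(`stringD_nextR`). So the product of `n` successive `r^{(k)}`, which is `τ^{(n)}/τ^{(0)}`, is
multiplied by `n x` under `S`. This product is also the Wronskian (`wronskian_eq_prod_gaugeR`):
taking `r` out of every entry leaves a last entry `1`, and expanding leaves a Wronskian one size
smaller, built from the gauge-transformed chain.

Two kinds of groundwork support this: finite-order operators form a ring, and the infinite sums in
`S` and `M` become finite once all but finitely many variables are set to `0` (`Cong`). -/

theorem pd_add (l : ℕ+) (f g : Fn K) : pd l (f + g) = pd l f + pd l g := map_add _ f g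
theorem pd_neg (l : ℕ+) (f : Fn K) : pd l (-f) = -pd l f := map_neg _ f
theorem pd_sub (l : ℕ+) (f g : Fn K) : pd l (f - g) = pd l f - pd l g := map_sub _ f g
@[simp] theorem pd_zero (l : ℕ+) : pd l (0 : Fn K) = 0 := map_zero _
@[simp] theorem pd_one (l : ℕ+) : pd l (1 : Fn K) = 0 :=
  (MvPowerSeries.pderiv K l).map_one_eq_zero

theorem pd_sum (l : ℕ+) {ι : Type*} (s : Finset ι) (f : ι → Fn K) :
    pd l (∑ i ∈ s, f i) = ∑ i ∈ s, pd l (f i) := map_sum _ f s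

theorem pd_zsmul (l : ℕ+) (n : ℤ) (f : Fn K) : pd l (n • f) = n • pd l f := map_zsmul _ n f

theorem pd_mul (l : ℕ+) (f g : Fn K) : pd l (f * g) = f * pd l g + pd l f * g := by
  have := (MvPowerSeries.pderiv K l).leibniz f g
  simp only [smul_eq_mul] at this
  simp only [pd, this, mul_comm g]

@[simp] theorem pd_natCast (l : ℕ+) (n : ℕ) : pd l (n : Fn K) = 0 :=
  (MvPowerSeries.pderiv K l).map_natCast n

theorem pd_iterate_zero (l : ℕ+) (k : ℕ) : (pd l)^[k] (0 : Fn K) = 0 :=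
  Function.iterate_fixed (pd_zero l) k

theorem pd_iterate_add (l : ℕ+) (k : ℕ) (f g : Fn K) :
    (pd l)^[k] (f + g) = (pd l)^[k] f + (pd l)^[k] g := by
  induction k with
  | zero => rfl
  | succ k ih => simp only [Function.iterate_succ_apply', ih, pd_add]

theorem pd_iterate_mul_of_const (l : ℕ+) (k : ℕ) {f : Fn K} (hf : pd l f = 0) (g : Fn K) :
    (pd l)^[k] (f * g) = f * (pd l)^[k] g := by
  induction k with
  | zero => rfl
  | succ k ih => simp only [Function.iterate_succ_apply', ih, pd_mul, hf, zero_mul, add_zero]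

theorem csum_eq_sum {ι : Type*} {f : ι → Fn K} (s : Finset ι) (h : ∀ i, i ∉ s → f i = 0) :
    csum f = ∑ i ∈ s, f i := by
  ext α
  have h1 : MvPowerSeries.coeff α (csum f) = ∑ᶠ i, MvPowerSeries.coeff α (f i) := rfl
  rw [h1, map_sum]
  apply finsum_eq_sum_of_support_subset
  intro i hi
  by_contra hn
  exact hi (by simp only [h i hn, map_zero])

namespace PDO

/-! ### Operators of finite order -/

/-- The order of `a` is at most `A`. -/
def OrderLE (A : ℤ) (a : PDO K) : Prop := ∀ i, A < i → a.coeff i = 0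

theorem OrderLE.mono {A B : ℤ} {a : PDO K} (h : OrderLE A a) (hAB : A ≤ B) : OrderLE B a :=
  fun i hi => h i (lt_of_le_of_lt hAB hi)

@[simp] theorem coeff_add (a b : PDO K) (i : ℤ) : (a + b).coeff i = a.coeff i + b.coeff i := rfl
@[simp] theorem coeff_neg (a : PDO K) (i : ℤ) : (-a).coeff i = -a.coeff i := rfl
@[simp] theorem coeff_sub (a b : PDO K) (i : ℤ) : (a - b).coeff i = a.coeff i - b.coeff i := rfl
theorem coeff_one (i : ℤ) : (1 : PDO K).coeff i = if i = 0 then 1 else 0 := rfl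
theorem coeff_ofFn (f : Fn K) (i : ℤ) : (ofFn f).coeff i = if i = 0 then f else 0 := rfl
theorem coeff_dpow (j i : ℤ) : (dpow j : PDO K).coeff i = if i = j then 1 else 0 := rfl
theorem coeff_pos (a : PDO K) (i : ℤ) : a.pos.coeff i = if 0 ≤ i then a.coeff i else 0 := rfl
theorem coeff_negPart (a : PDO K) (i : ℤ) : a.neg.coeff i = if i < 0 then a.coeff i else 0 := rfl

theorem orderLE_dpow (i : ℤ) : OrderLE i (dpow i : PDO K) := fun j hj => by
  rw [coeff_dpow, if_neg (by omega)]

theorem orderLE_ofFn (f : Fn K) : OrderLE 0 (ofFn f) := fun j hj => by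
  rw [coeff_ofFn, if_neg (by omega)]

theorem coeff_mul (a b : PDO K) (m : ℤ) : (a * b).coeff m = csum fun p : ℤ × ℕ =>
    Ring.choose p.1 p.2 • (a.coeff p.1 * (pd 1)^[p.2] (b.coeff (m - p.1 + p.2))) := rfl

/-- Outside the box one of the two order bounds kills the term. `L` and `N` may be taken with slack,
so that several products can be expanded over one common box. -/
theorem coeff_mul_eq_sum {a b : PDO K} {A B : ℤ} (ha : OrderLE A a) (hb : OrderLE B b)
    {m L : ℤ} {N : ℕ} (hL : L ≤ m - B) (hN : A + B < m + N) :
    (a * b).coeff m = ∑ i ∈ Finset.Icc L A, ∑ k ∈ Finset.range N,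
      Ring.choose i k • (a.coeff i * (pd 1)^[k] (b.coeff (m - i + k))) := by
  rw [coeff_mul, csum_eq_sum (Finset.Icc L A ×ˢ Finset.range N), Finset.sum_product]
  rintro ⟨i, k⟩ h
  simp only [Finset.mem_product, Finset.mem_Icc, Finset.mem_range, not_and_or, not_le, not_lt] at h
  dsimp only
  by_cases hi : A < i
  · rw [ha i hi, zero_mul, smul_zero]
  · rw [hb (m - i + k) (by omega), pd_iterate_zero, mul_zero, smul_zero]

theorem coeff_dpow_mul {b : PDO K} {B : ℤ} (hb : OrderLE B b) (i : ℤ) {m : ℤ} {N : ℕ}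
    (hN : B < m - i + N) :
    (dpow i * b).coeff m =
      ∑ k ∈ Finset.range N, Ring.choose i k • (pd 1)^[k] (b.coeff (m - i + k)) := by
  rw [coeff_mul, csum_eq_sum ({i} ×ˢ Finset.range N), Finset.sum_product, Finset.sum_singleton]
  · simp only [coeff_dpow, if_true, one_mul]
  rintro ⟨j, k⟩ h
  simp only [Finset.mem_product, Finset.mem_singleton, Finset.mem_range, not_and_or, not_lt] at h
  dsimp only
  by_cases hj : j = i
  · rw [hb (m - j + k) (by omega), pd_iterate_zero, mul_zero, smul_zero]
  · rw [coeff_dpow, if_neg hj, zero_mul, smul_zero]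

theorem OrderLE.mul {a b : PDO K} {A B : ℤ} (ha : OrderLE A a) (hb : OrderLE B b) :
    OrderLE (A + B) (a * b) := by
  intro m hm
  rw [coeff_mul, csum_eq_sum ∅, Finset.sum_empty]
  rintro ⟨i, k⟩ -
  dsimp only
  by_cases hi : A < i
  · rw [ha i hi, zero_mul, smul_zero]
  · rw [hb (m - i + k) (by omega), pd_iterate_zero, mul_zero, smul_zero]

/-- Function coefficients factor out on the left, so identities for products reduce to the case
where the left factor is `∂^i`. -/
theorem coeff_mul_eq_sum_dpow {a b : PDO K} {A B : ℤ} (ha : OrderLE A a) (hb : OrderLE B b)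
    {m L : ℤ} (hL : L ≤ m - B) :
    (a * b).coeff m = ∑ i ∈ Finset.Icc L A, a.coeff i * (dpow i * b).coeff m := by
  obtain ⟨N, hN⟩ : ∃ N : ℕ, A + B < m + N := ⟨(A + B - m).toNat + 1, by omega⟩
  rw [coeff_mul_eq_sum ha hb hL hN]
  refine Finset.sum_congr rfl fun i hi => ?_
  rw [Finset.mem_Icc] at hi
  rw [coeff_dpow_mul hb i (N := N) (by omega), Finset.mul_sum]
  exact Finset.sum_congr rfl fun k _ => (mul_smul_comm _ _ _).symm

theorem coeff_D_mul (b : PDO K) (m : ℤ) :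
    (dpow 1 * b).coeff m = b.coeff (m - 1) + pd 1 (b.coeff m) := by
  rw [coeff_mul, csum_eq_sum ({1} ×ˢ Finset.range 2), Finset.sum_product, Finset.sum_singleton]
  · simp [Finset.sum_range_succ, coeff_dpow]
  rintro ⟨j, k⟩ h
  simp only [Finset.mem_product, Finset.mem_singleton, Finset.mem_range, not_and_or, not_lt] at h
  dsimp only
  by_cases hj : j = 1
  · subst hj
    have : Ring.choose (1 : ℤ) k = 0 := by
      have h1 := Ring.choose_natCast (R := ℤ) 1 k
      rw [Nat.cast_one] at h1
      rw [h1, Nat.choose_eq_zero_of_lt (by omega), Nat.cast_zero]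
    rw [this, zero_smul]
  · rw [coeff_dpow, if_neg hj, zero_mul, smul_zero]

theorem coeff_ofFn_mul (f : Fn K) (b : PDO K) (m : ℤ) :
    (ofFn f * b).coeff m = f * b.coeff m := by
  rw [coeff_mul, csum_eq_sum ({0} ×ˢ Finset.range 1), Finset.sum_product, Finset.sum_singleton]
  · simp [coeff_ofFn]
  rintro ⟨j, k⟩ h
  simp only [Finset.mem_product, Finset.mem_singleton, Finset.mem_range, not_and_or, not_lt] at h
  dsimp only
  by_cases hj : j = 0
  · subst hj
    rw [Ring.choose_zero_pos ℤ (by omega), zero_smul]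
  · rw [coeff_ofFn, if_neg hj, zero_mul, smul_zero]

theorem dpow_zero : (dpow 0 : PDO K) = 1 := rfl

theorem one_mul' (b : PDO K) : 1 * b = b := by
  ext1
  funext m
  exact (coeff_ofFn_mul 1 b m).trans (one_mul _)

theorem mul_one' (b : PDO K) : b * 1 = b := by
  ext1
  funext m
  rw [coeff_mul, csum_eq_sum {(m, 0)}, Finset.sum_singleton]
  · simp [coeff_one]
  rintro ⟨j, k⟩ h
  simp only [Finset.mem_singleton, Prod.mk.injEq, not_and] at h
  dsimp only
  rw [coeff_one]
  split_ifs with hk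
  · cases k with
    | zero => exact absurd rfl (h (by push_cast at hk; omega))
    | succ k =>
      rw [Function.iterate_succ_apply, pd_one, pd_iterate_zero, mul_zero, smul_zero]
  · rw [pd_iterate_zero, mul_zero, smul_zero]

/-! ### Associativity of the operator product -/

/-- Pascal's rule for generalized binomial coefficients, valid for negative `i` as well. -/
theorem D_mul_dpow_mul {b : PDO K} {B : ℤ} (hb : OrderLE B b) (i : ℤ) :
    dpow 1 * (dpow i * b) = dpow (i + 1) * b := by
  ext1
  funext m
  obtain ⟨N, hN⟩ : ∃ N : ℕ, B < m - i - 1 + N := ⟨(B - (m - i - 1)).toNat + 1, by omega⟩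
  rw [coeff_D_mul, coeff_dpow_mul hb i (m := m - 1) (N := N + 1) (by push_cast; omega),
    coeff_dpow_mul hb i (m := m) (N := N) (by omega),
    coeff_dpow_mul hb (i + 1) (m := m) (N := N + 1) (by push_cast; omega), pd_sum,
    Finset.sum_range_succ', Finset.sum_range_succ', add_right_comm, ← Finset.sum_add_distrib]
  congr 1
  · refine Finset.sum_congr rfl fun k _ => ?_
    rw [pd_zsmul, ← Function.iterate_succ_apply' (pd 1), Ring.choose_succ_succ, add_smul, add_comm]
    congr 4 <;> push_cast <;> ring_nf
  · simp only [Ring.choose_zero_right]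
    congr 3
    push_cast
    ring

/-- The relation `b_{m-1} = -∂_x b_m` propagates vanishing downwards, starting just above the order
of `b`. -/
theorem eq_zero_of_D_mul {b : PDO K} {B : ℤ} (hb : OrderLE B b)
    (h : ∀ m, (dpow 1 * b).coeff m = 0) (m : ℤ) : b.coeff m = 0 := by
  have key : ∀ n : ℕ, b.coeff (B + 1 - n) = 0 := by
    intro n
    induction n with
    | zero => exact hb _ (by simp)
    | succ n ih =>
      have := h (B + 1 - n)
      rw [coeff_D_mul, ih, pd_zero, add_zero] at this
      rw [← this]
      congr 1
      push_cast
      ring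
  by_cases hm : B < m
  · exact hb m hm
  · have := key (B + 1 - m).toNat
    rwa [show B + 1 - ((B + 1 - m).toNat : ℤ) = m by omega] at this

/-- The Leibniz rule applied to each `b_i (∂^i c)_m`. The shifted sums are compared after extending
them by terms that vanish by the order bounds. -/
theorem D_mul_mul {b c : PDO K} {B C : ℤ} (hb : OrderLE B b) (hc : OrderLE C c) :
    dpow 1 * b * c = dpow 1 * (b * c) := by
  ext1
  funext m
  have hDb := (orderLE_dpow (K := K) 1).mul hb
  rw [coeff_mul_eq_sum_dpow hDb hc (L := m - C) le_rfl, coeff_D_mul,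
    coeff_mul_eq_sum_dpow (hb.mono (show B ≤ B + 1 by omega)) hc (m := m)
      (L := m - C) le_rfl,
    coeff_mul_eq_sum_dpow hb hc (m := m - 1) (L := m - 1 - C) le_rfl, pd_sum]
  have e : ∑ i ∈ Finset.Icc (m - 1 - C) B, b.coeff i * (dpow i * c).coeff (m - 1) =
      ∑ i ∈ Finset.Icc (m - C) (1 + B), b.coeff (i - 1) * (dpow (i - 1) * c).coeff (m - 1) := by
    refine Finset.sum_nbij' (· + 1) (· - 1) ?_ ?_ ?_ ?_ ?_ <;>
      simp only [Finset.mem_Icc] <;> intros <;> first | omega | simp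
  have e2 : ∑ i ∈ Finset.Icc (m - C) (B + 1), pd 1 (b.coeff i * (dpow i * c).coeff m) =
      ∑ i ∈ Finset.Icc (m - C) (1 + B), b.coeff (i - 1) * pd 1 ((dpow (i - 1) * c).coeff m) +
      ∑ i ∈ Finset.Icc (m - C) (1 + B), pd 1 (b.coeff i) * (dpow i * c).coeff m := by
    have e3 : ∑ i ∈ Finset.Icc (m - C) (1 + B), b.coeff (i - 1) * pd 1 ((dpow (i - 1) * c).coeff m)
        = ∑ i ∈ Finset.Icc (m - C) (B + 1), b.coeff i * pd 1 ((dpow i * c).coeff m) := by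
      have e4 : ∑ i ∈ Finset.Icc (m - C) (1 + B),
          b.coeff (i - 1) * pd 1 ((dpow (i - 1) * c).coeff m) =
          ∑ i ∈ Finset.Icc (m - C - 1) B, b.coeff i * pd 1 ((dpow i * c).coeff m) := by
        refine Finset.sum_nbij' (· - 1) (· + 1) ?_ ?_ ?_ ?_ ?_ <;>
          simp only [Finset.mem_Icc] <;> intros <;> first | omega | simp
      rw [e4]
      have s1 : Finset.Icc (m - C) (B + 1) ⊆ Finset.Icc (m - C - 1) (B + 1) :=
        Finset.Icc_subset_Icc (by omega) le_rfl
      have s2 : Finset.Icc (m - C - 1) B ⊆ Finset.Icc (m - C - 1) (B + 1) :=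
        Finset.Icc_subset_Icc le_rfl (by omega)
      rw [Finset.sum_subset s1, Finset.sum_subset s2]
      · intro i hi hi'
        simp only [Finset.mem_Icc] at hi hi'
        rw [hb i (by omega), zero_mul]
      · intro i hi hi'
        simp only [Finset.mem_Icc] at hi hi'
        rw [(orderLE_dpow (K := K) i).mul hc m (by omega), pd_zero, mul_zero]
    rw [e3, add_comm 1 B, ← Finset.sum_add_distrib]
    exact Finset.sum_congr rfl fun i _ => pd_mul _ _ _
  rw [e, e2, ← add_assoc, ← Finset.sum_add_distrib, ← Finset.sum_add_distrib]
  refine Finset.sum_congr rfl fun i _ => ?_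
  have h1 : (dpow i * c).coeff m = (dpow (i - 1) * c).coeff (m - 1) +
      pd 1 ((dpow (i - 1) * c).coeff m) := by
    rw [← coeff_D_mul, D_mul_dpow_mul hc, sub_add_cancel]
  rw [coeff_D_mul, add_mul]
  nth_rewrite 1 [h1]
  ring

/-- Upward induction applies one more `∂`; downward induction cancels one, by injectivity of left
multiplication by `∂` on finite-order operators. -/
theorem dpow_mul_mul {b c : PDO K} {B C : ℤ} (hb : OrderLE B b) (hc : OrderLE C c) (i : ℤ) :
    dpow i * b * c = dpow i * (b * c) := by
  induction i using Int.induction_on with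
  | zero => rw [dpow_zero, one_mul', one_mul']
  | succ i ih =>
    rw [← D_mul_dpow_mul hb, ← D_mul_dpow_mul (hb.mul hc), ← ih,
      D_mul_mul ((orderLE_dpow _).mul hb) hc]
  | pred i ih =>
    have hbi := (orderLE_dpow (K := K) (-i - 1)).mul hb
    have h1 : dpow 1 * (dpow (-i - 1 : ℤ) * b * c) = dpow 1 * (dpow (-i - 1 : ℤ) * (b * c)) := by
      rw [← D_mul_mul hbi hc, D_mul_dpow_mul hb, D_mul_dpow_mul (hb.mul hc), sub_add_cancel, ih]
    have hord : OrderLE (-i - 1 + B + C)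
        (dpow (-i - 1 : ℤ) * b * c - dpow (-i - 1 : ℤ) * (b * c)) := by
      intro j hj
      rw [coeff_sub, hbi.mul hc j hj, (orderLE_dpow (K := K) (-i - 1)).mul (hb.mul hc) j (by omega),
        sub_zero]
    have h0 := eq_zero_of_D_mul hord (fun m => by
      have h2 := congrArg (fun x => PDO.coeff x m) h1
      simp only [coeff_D_mul] at h2
      rw [coeff_D_mul, coeff_sub, coeff_sub, pd_sub]
      linear_combination h2)
    ext1
    funext m
    exact sub_eq_zero.1 (h0 m)

theorem mul_assoc' {a b c : PDO K} {A B C : ℤ} (ha : OrderLE A a) (hb : OrderLE B b)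
    (hc : OrderLE C c) : a * b * c = a * (b * c) := by
  ext1
  funext m
  rw [coeff_mul_eq_sum_dpow (ha.mul hb) hc (L := m - C) le_rfl,
    coeff_mul_eq_sum_dpow ha (hb.mul hc) (L := m - (B + C)) le_rfl]
  have e : ∀ p ∈ Finset.Icc (m - C) (A + B), (a * b).coeff p * (dpow p * c).coeff m =
      ∑ i ∈ Finset.Icc (m - (B + C)) A,
        a.coeff i * ((dpow i * b).coeff p * (dpow p * c).coeff m) := by
    intro p hp
    rw [Finset.mem_Icc] at hp
    rw [coeff_mul_eq_sum_dpow ha hb (L := m - (B + C)) (by omega), Finset.sum_mul]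
    exact Finset.sum_congr rfl fun i _ => mul_assoc _ _ _
  rw [Finset.sum_congr rfl e, Finset.sum_comm]
  refine Finset.sum_congr rfl fun i hi => ?_
  rw [Finset.mem_Icc] at hi
  rw [← Finset.mul_sum, ← dpow_mul_mul hb hc,
    coeff_mul_eq_sum_dpow (((orderLE_dpow (K := K) i).mul hb).mono (show i + B ≤ A + B by omega))
      hc (L := m - C) le_rfl]

/-! ### Sums and distributivity -/

theorem OrderLE.add {a b : PDO K} {A B : ℤ} (ha : OrderLE A a) (hb : OrderLE B b) :
    OrderLE (max A B) (a + b) := fun i hi => by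
  rw [coeff_add, ha i (by omega), hb i (by omega), add_zero]

theorem OrderLE.neg {a : PDO K} {A : ℤ} (ha : OrderLE A a) : OrderLE A (-a) := fun i hi => by
  rw [coeff_neg, ha i hi, neg_zero]

theorem OrderLE.sub {a b : PDO K} {A B : ℤ} (ha : OrderLE A a) (hb : OrderLE B b) :
    OrderLE (max A B) (a - b) := fun i hi => by
  rw [coeff_sub, ha i (by omega), hb i (by omega), sub_zero]

theorem add_mul' {a b c : PDO K} {A C : ℤ} (ha : OrderLE A a) (hb : OrderLE A b)
    (hc : OrderLE C c) : (a + b) * c = a * c + b * c := by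
  ext1
  funext m
  rw [coeff_mul_eq_sum_dpow ((ha.add hb).mono (max_self A).le) hc (L := m - C) le_rfl,
    coeff_add, coeff_mul_eq_sum_dpow ha hc (L := m - C) le_rfl,
    coeff_mul_eq_sum_dpow hb hc (L := m - C) le_rfl, ← Finset.sum_add_distrib]
  exact Finset.sum_congr rfl fun i _ => add_mul _ _ _

theorem mul_add' {a b c : PDO K} {A C : ℤ} (ha : OrderLE A a) (hb : OrderLE C b)
    (hc : OrderLE C c) : a * (b + c) = a * b + a * c := by
  ext1
  funext m
  obtain ⟨N, hN⟩ : ∃ N : ℕ, A + C < m + N := ⟨(A + C - m).toNat + 1, by omega⟩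
  rw [coeff_mul_eq_sum ha ((hb.add hc).mono (max_self C).le) (L := m - C) (N := N) le_rfl
      hN,
    coeff_add, coeff_mul_eq_sum ha hb (L := m - C) (N := N) le_rfl hN,
    coeff_mul_eq_sum ha hc (L := m - C) (N := N) le_rfl hN,
    ← Finset.sum_add_distrib]
  refine Finset.sum_congr rfl fun i _ => ?_
  rw [← Finset.sum_add_distrib]
  refine Finset.sum_congr rfl fun k _ => ?_
  rw [coeff_add, pd_iterate_add, mul_add, smul_add]

theorem zero_mul' (a : PDO K) : ofFn 0 * a = ofFn 0 := by
  ext1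
  funext m
  rw [coeff_ofFn_mul, zero_mul, coeff_ofFn, ite_self]

theorem mul_zero' (a : PDO K) : a * ofFn 0 = ofFn 0 := by
  ext1
  funext m
  rw [coeff_mul, csum_eq_sum ∅, Finset.sum_empty, coeff_ofFn, ite_self]
  intro p _
  rw [coeff_ofFn, ite_self, pd_iterate_zero, mul_zero, smul_zero]

end PDO

/-- Pseudo-differential operators of finite order. -/
structure FinPDO (K : Type*) [Field K] where
  /-- The underlying symbol. -/
  val : PDO K
  exists_orderLE : ∃ A, PDO.OrderLE A val

/-! ### The ring of operators of finite order -/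

namespace FinPDO

open PDO

theorem val_ext {a b : FinPDO K} (h : a.1 = b.1) : a = b := by
  cases a
  congr

@[ext] theorem ext {a b : FinPDO K} (h : ∀ i, a.1.coeff i = b.1.coeff i) : a = b :=
  val_ext (PDO.ext (funext h))

theorem exists_common (a b : FinPDO K) : ∃ A, OrderLE A a.1 ∧ OrderLE A b.1 := by
  obtain ⟨A, hA⟩ := a.2
  obtain ⟨B, hB⟩ := b.2
  exact ⟨max A B, hA.mono (le_max_left _ _), hB.mono (le_max_right _ _)⟩

instance : Zero (FinPDO K) := ⟨⟨ofFn 0, 0, orderLE_ofFn 0⟩⟩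
instance : One (FinPDO K) := ⟨⟨1, 0, orderLE_ofFn 1⟩⟩
instance : Add (FinPDO K) :=
  ⟨fun a b => ⟨a.1 + b.1, let ⟨_, hA⟩ := a.2; let ⟨_, hB⟩ := b.2; ⟨_, hA.add hB⟩⟩⟩
instance : Neg (FinPDO K) := ⟨fun a => ⟨-a.1, let ⟨_, hA⟩ := a.2; ⟨_, hA.neg⟩⟩⟩
instance : Sub (FinPDO K) :=
  ⟨fun a b => ⟨a.1 - b.1, let ⟨_, hA⟩ := a.2; let ⟨_, hB⟩ := b.2; ⟨_, hA.sub hB⟩⟩⟩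
instance : Mul (FinPDO K) :=
  ⟨fun a b => ⟨a.1 * b.1, let ⟨_, hA⟩ := a.2; let ⟨_, hB⟩ := b.2; ⟨_, hA.mul hB⟩⟩⟩

theorem val_zero_coeff (i : ℤ) : (0 : FinPDO K).1.coeff i = 0 := ite_self _

instance : Ring (FinPDO K) where
  add_assoc a b c := FinPDO.ext fun i => add_assoc _ _ _
  zero_add a := FinPDO.ext fun i => by
    change (0 : FinPDO K).1.coeff i + _ = _
    rw [val_zero_coeff, zero_add]
  add_zero a := FinPDO.ext fun i => by
    change _ + (0 : FinPDO K).1.coeff i = _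
    rw [val_zero_coeff, add_zero]
  add_comm a b := FinPDO.ext fun i => add_comm _ _
  nsmul := nsmulRec
  zsmul := zsmulRec
  neg_add_cancel a := FinPDO.ext fun i => by
    rw [val_zero_coeff]
    exact neg_add_cancel _
  sub_eq_add_neg a b := FinPDO.ext fun i => sub_eq_add_neg _ _
  left_distrib a b c := by
    obtain ⟨A, hA⟩ := a.2
    obtain ⟨B, hb, hc⟩ := exists_common b c
    exact val_ext (mul_add' hA hb hc)
  right_distrib a b c := by
    obtain ⟨A, hA⟩ := c.2
    obtain ⟨B, hb, hc⟩ := exists_common a b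
    exact val_ext (add_mul' hb hc hA)
  zero_mul a := val_ext (zero_mul' a.1)
  mul_zero a := val_ext (mul_zero' a.1)
  mul_assoc a b c := by
    obtain ⟨_, ha⟩ := a.2
    obtain ⟨_, hb⟩ := b.2
    obtain ⟨_, hc⟩ := c.2
    exact val_ext (mul_assoc' ha hb hc)
  one_mul a := val_ext (one_mul' a.1)
  mul_one a := val_ext (mul_one' a.1)

@[simp] theorem coeff_zero (i : ℤ) : (0 : FinPDO K).1.coeff i = 0 := val_zero_coeff i
@[simp] theorem val_add (a b : FinPDO K) : (a + b).1 = a.1 + b.1 := rfl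
@[simp] theorem val_sub (a b : FinPDO K) : (a - b).1 = a.1 - b.1 := rfl
@[simp] theorem val_neg (a : FinPDO K) : (-a).1 = -a.1 := rfl
@[simp] theorem val_mul (a b : FinPDO K) : (a * b).1 = a.1 * b.1 := rfl

theorem val_pow (a : FinPDO K) (n : ℕ) : (a ^ n).1 = opPow a.1 n := by
  induction n with
  | zero => rfl
  | succ n ih => rw [pow_succ, val_mul, ih]; rfl

/-- Multiplication by a function. -/
def fn (f : Fn K) : FinPDO K := ⟨ofFn f, 0, orderLE_ofFn f⟩

/-- The operator `∂^i`. -/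
def D (i : ℤ) : FinPDO K := ⟨dpow i, i, orderLE_dpow i⟩

@[simp] theorem val_fn (f : Fn K) : (fn f).1 = ofFn f := rfl
@[simp] theorem val_D (i : ℤ) : (D i : FinPDO K).1 = dpow i := rfl

theorem fn_mul (f g : Fn K) : fn (f * g) = fn f * fn g := FinPDO.ext fun i => by
  rw [val_mul, val_fn, val_fn, coeff_ofFn_mul, val_fn, coeff_ofFn, coeff_ofFn, mul_ite, mul_zero]

theorem fn_add (f g : Fn K) : fn (f + g) = fn f + fn g := FinPDO.ext fun i => by
  simp only [val_fn, val_add, coeff_add, coeff_ofFn]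
  split_ifs <;> simp

theorem fn_one : (fn 1 : FinPDO K) = 1 := rfl
theorem fn_zero : (fn 0 : FinPDO K) = 0 := rfl

theorem D_one_mul_fn (f : Fn K) : D 1 * fn f = fn f * D 1 + fn (pd 1 f) := FinPDO.ext fun i => by
  simp only [val_mul, val_add, val_fn, val_D, coeff_add, coeff_D_mul, coeff_ofFn_mul, coeff_ofFn,
    coeff_dpow]
  split_ifs <;> first | omega | simp

theorem D_one_mul_D (i : ℤ) : (D 1 * D i : FinPDO K) = D (i + 1) := FinPDO.ext fun m => by
  simp only [val_mul, val_D, coeff_D_mul, coeff_dpow]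
  split_ifs <;> first | omega | simp

theorem D_zero : (D 0 : FinPDO K) = 1 := rfl

theorem D_mul_neg_one : (D 1 * D (-1) : FinPDO K) = 1 := by
  rw [D_one_mul_D, neg_add_cancel, D_zero]

theorem D_one_injective {a b : FinPDO K} (h : D 1 * a = D 1 * b) : a = b := by
  obtain ⟨A, hA⟩ := (a - b).2
  rw [← sub_eq_zero]
  refine FinPDO.ext fun i => ?_
  rw [coeff_zero]
  refine eq_zero_of_D_mul hA (fun m => ?_) i
  have : (D 1 * (a - b)).1.coeff m = 0 := by rw [mul_sub, h, sub_self, coeff_zero]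
  exact this

theorem D_neg_one_mul : (D (-1) * D 1 : FinPDO K) = 1 :=
  D_one_injective (by rw [← mul_assoc, D_mul_neg_one, one_mul, mul_one])

theorem D_natCast (n : ℕ) : (D n : FinPDO K) = D 1 ^ n := by
  induction n with
  | zero => rfl
  | succ n ih => rw [pow_succ', ← ih, D_one_mul_D, Nat.cast_succ]

/-- A function that does not depend on `x` commutes with all operators. -/
theorem mul_fn_of_const {f : Fn K} (hf : pd 1 f = 0) (a : FinPDO K) : a * fn f = fn f * a := by
  refine FinPDO.ext fun m => ?_
  rw [val_mul, val_mul, val_fn, coeff_ofFn_mul, coeff_mul, csum_eq_sum {(m, 0)},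
    Finset.sum_singleton]
  · simp [coeff_ofFn, mul_comm f]
  rintro ⟨j, k⟩ h
  simp only [Finset.mem_singleton, Prod.mk.injEq, not_and] at h
  dsimp only
  rw [coeff_ofFn]
  split_ifs with hk
  · cases k with
    | zero => exact absurd rfl (h (by push_cast at hk; omega))
    | succ k =>
      rw [Function.iterate_succ_apply, hf, pd_iterate_zero, mul_zero, smul_zero]
  · rw [pd_iterate_zero, mul_zero, smul_zero]

end FinPDO

/-! ### Congruence of power series on a finite set of variables -/

theorem coeff_csum {ι : Type*} (f : ι → Fn K) (α : ℕ+ →₀ ℕ) :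
    MvPowerSeries.coeff α (csum f) = ∑ᶠ i, MvPowerSeries.coeff α (f i) := rfl

/-- `f` and `g` agree once the variables outside `F` are set to `0`. -/
def Cong (F : Finset ℕ+) (f g : Fn K) : Prop :=
  ∀ β : ℕ+ →₀ ℕ, β.support ⊆ F → MvPowerSeries.coeff β f = MvPowerSeries.coeff β g

namespace Cong

variable {F : Finset ℕ+} {f g h f' g' : Fn K}

theorem refl (F : Finset ℕ+) (f : Fn K) : Cong F f f := fun _ _ => rfl
theorem symm (h : Cong F f g) : Cong F g f := fun β hβ => (h β hβ).symm
theorem trans (h₁ : Cong F f g) (h₂ : Cong F g h) : Cong F f h :=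
  fun β hβ => (h₁ β hβ).trans (h₂ β hβ)

theorem add (h₁ : Cong F f g) (h₂ : Cong F f' g') : Cong F (f + f') (g + g') := fun β hβ => by
  rw [map_add, map_add, h₁ β hβ, h₂ β hβ]

theorem zsmul (n : ℤ) (h₁ : Cong F f g) : Cong F (n • f) (n • g) := fun β hβ => by
  rw [map_zsmul, map_zsmul, h₁ β hβ]

theorem mul (h₁ : Cong F f g) (h₂ : Cong F f' g') : Cong F (f * f') (g * g') := fun β hβ => by
  classical
  rw [MvPowerSeries.coeff_mul, MvPowerSeries.coeff_mul]
  refine Finset.sum_congr rfl fun p hp => ?_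
  have hle := Finset.HasAntidiagonal.mem_antidiagonal.1 hp
  rw [h₁ p.1 ((Finsupp.support_mono (hle ▸ self_le_add_right p.1 p.2)).trans hβ),
    h₂ p.2 ((Finsupp.support_mono (hle ▸ self_le_add_left p.2 p.1)).trans hβ)]

theorem pd {l : ℕ+} (hl : l ∈ F) (h₁ : Cong F f g) : Cong F (pd l f) (pd l g) := fun β hβ => by
  classical
  simp only [CKP.pd, MvPowerSeries.coeff_pderiv]
  rw [h₁]
  refine Finsupp.support_add.trans (Finset.union_subset hβ ?_)
  exact Finsupp.support_single_subset.trans (Finset.singleton_subset_iff.2 hl)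

theorem pd_iterate {l : ℕ+} (hl : l ∈ F) (h₁ : Cong F f g) (k : ℕ) :
    Cong F ((CKP.pd l)^[k] f) ((CKP.pd l)^[k] g) := by
  induction k with
  | zero => exact h₁
  | succ k ih => simpa only [Function.iterate_succ_apply'] using ih.pd hl

theorem csum {ι : Type*} {f g : ι → Fn K} (h : ∀ i, Cong F (f i) (g i)) :
    Cong F (csum f) (csum g) := fun β hβ => by
  rw [coeff_csum, coeff_csum]
  exact finsum_congr fun i => h i β hβ

theorem csum_sum {ι : Type*} {f : ι → Fn K} (s : Finset ι) (h : ∀ i, i ∉ s → Cong F (f i) 0) :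
    Cong F (CKP.csum f) (∑ i ∈ s, f i) := fun β hβ => by
  rw [coeff_csum, map_sum]
  apply finsum_eq_sum_of_support_subset
  intro i hi
  by_contra hn
  exact hi ((h i hn β hβ).trans (map_zero _))

theorem of_eq (h : f = g) : Cong F f g := h ▸ Cong.refl F f

end Cong

/-- Two power series are equal if they are congruent on all large finite sets of variables. -/
theorem eq_of_cong (F₀ : Finset ℕ+) {f g : Fn K} (h : ∀ F, F₀ ⊆ F → Cong F f g) : f = g := by
  classical
  ext α
  exact h (F₀ ∪ α.support) Finset.subset_union_left α Finset.subset_union_right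

/-- This is where finiteness of the support of the base point enters: all but finitely many times
vanish modulo `F`, which truncates the sums over `l`. -/
theorem cong_time_zero {c : ℕ+ →₀ K} {F : Finset ℕ+} (hc : c.support ⊆ F) {l : ℕ+} (hl : l ∉ F) :
    Cong F (time c l) 0 := fun β hβ => by
  classical
  have hcl : c l = 0 := Finsupp.notMem_support_iff.1 fun h => hl (hc h)
  rw [time, hcl, map_zero, zero_add, map_zero, MvPowerSeries.coeff_X, if_neg]
  rintro rfl
  exact hl (hβ (by simp))

/-! ### The string operator -/

/-- The indices `l` with `l + 1 ∈ F`. -/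
def predSet (F : Finset ℕ+) : Finset ℕ+ :=
  F.preimage (· + 1) (fun _ _ _ _ h => add_right_cancel h)

theorem mem_predSet {F : Finset ℕ+} {l : ℕ+} : l ∈ predSet F ↔ l + 1 ∈ F :=
  Finset.mem_preimage

theorem stringD_cong {c : ℕ+ →₀ K} {F : Finset ℕ+} (hc : c.support ⊆ F) (f : Fn K) :
    Cong F (stringD c f)
      (∑ l ∈ predSet F, ((l : ℕ) + 1 : Fn K) * time c (l + 1) * pd l f) := by
  refine Cong.csum_sum _ fun l hl => ?_
  rw [mem_predSet] at hl
  simpa using ((Cong.refl F ((l : ℕ) + 1 : Fn K)).mul (cong_time_zero hc hl)).mul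
    (Cong.refl F (pd l f))

theorem stringD_add (c : ℕ+ →₀ K) (f g : Fn K) :
    stringD c (f + g) = stringD c f + stringD c g := by
  refine eq_of_cong c.support fun F hF => ?_
  refine (stringD_cong hF _).trans (Cong.trans (Cong.of_eq ?_)
    ((stringD_cong hF f).add (stringD_cong hF g)).symm)
  rw [← Finset.sum_add_distrib]
  exact Finset.sum_congr rfl fun l _ => by rw [pd_add]; ring

theorem stringD_mul (c : ℕ+ →₀ K) (f g : Fn K) :
    stringD c (f * g) = f * stringD c g + stringD c f * g := by
  refine eq_of_cong c.support fun F hF => ?_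
  refine (stringD_cong hF _).trans (Cong.trans (Cong.of_eq ?_)
    (((Cong.refl F f).mul (stringD_cong hF g)).add
      ((stringD_cong hF f).mul (Cong.refl F g))).symm)
  rw [Finset.mul_sum, Finset.sum_mul, ← Finset.sum_add_distrib]
  exact Finset.sum_congr rfl fun l _ => by rw [pd_mul]; ring

theorem pd_time_of_ne (c : ℕ+ →₀ K) {l m : ℕ+} (h : m ≠ l) : pd l (time c m) = 0 := by
  rw [time, pd_add]
  simp only [pd, MvPowerSeries.pderiv_C, zero_add]
  exact MvPowerSeries.pderiv_X_of_ne h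

theorem pd_time_self (c : ℕ+ →₀ K) (l : ℕ+) : pd l (time c l) = 1 := by
  rw [time, pd_add]
  simp only [pd, MvPowerSeries.pderiv_C, zero_add]
  exact MvPowerSeries.pderiv_X_self

theorem succ_ne_one (l : ℕ+) : l + 1 ≠ 1 := fun h => by
  have := congrArg PNat.val h
  have h2 := l.pos
  simp at this

theorem pd_comm (l m : ℕ+) (f : Fn K) : pd l (pd m f) = pd m (pd l f) := by
  classical
  ext β
  by_cases h : l = m
  · rw [h]
  simp only [pd, MvPowerSeries.coeff_pderiv, Finsupp.add_apply, Finsupp.single_apply, h,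
    Ne.symm h, if_false, add_zero, add_right_comm β (Finsupp.single l 1)]
  ring

/-- The coefficients `(l+1) t_{l+1}` have index at least `2`, so they are constant in `x`. -/
theorem stringD_pd (c : ℕ+ →₀ K) (f : Fn K) : stringD c (pd 1 f) = pd 1 (stringD c f) := by
  refine eq_of_cong (insert 1 c.support) fun F hF => ?_
  have hF' := (Finset.subset_insert _ _).trans hF
  have h1 : (1 : ℕ+) ∈ F := hF (Finset.mem_insert_self _ _)
  refine (stringD_cong hF' _).trans (Cong.trans (Cong.of_eq ?_)
    ((stringD_cong hF' f).pd h1).symm)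
  rw [pd_sum]
  refine Finset.sum_congr rfl fun l _ => ?_
  have hc : pd 1 (((l : ℕ) + 1 : Fn K) * time c (l + 1)) = 0 := by
    rw [pd_mul, pd_time_of_ne c (succ_ne_one l), pd_add, pd_natCast, pd_one]
    ring
  rw [pd_mul, hc, pd_comm]
  ring

@[simp] theorem stringD_one (c : ℕ+ →₀ K) : stringD c (1 : Fn K) = 0 := by
  have := stringD_mul c (1 : Fn K) 1
  rw [mul_one, mul_one, one_mul] at this
  exact left_eq_add.1 this

open PDO
/-! ### The Lax operator -/

namespace PDO

theorem coeff_mul_D (a : PDO K) (m : ℤ) : (a * dpow 1).coeff m = a.coeff (m - 1) := by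
  rw [coeff_mul, csum_eq_sum {(m - 1, 0)}, Finset.sum_singleton]
  · simp [coeff_dpow]
  rintro ⟨j, k⟩ h
  simp only [Finset.mem_singleton, Prod.mk.injEq, not_and] at h
  dsimp only
  rw [coeff_dpow]
  split_ifs with hk
  · cases k with
    | zero => exact absurd rfl (h (by push_cast at hk; omega))
    | succ k =>
      rw [Function.iterate_succ_apply, pd_one, pd_iterate_zero, mul_zero, smul_zero]
  · rw [pd_iterate_zero, mul_zero, smul_zero]

theorem orderLE_neg (a : PDO K) : OrderLE (-1) a.neg := fun i hi => by
  rw [coeff_negPart, if_neg (by omega)]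

theorem OrderLE.pos {A : ℤ} {a : PDO K} (ha : OrderLE A a) : OrderLE A a.pos := fun i hi => by
  rw [coeff_pos, ha i hi, ite_self]

theorem IsMonicZero.orderLE {a : PDO K} (ha : a.IsMonicZero) : OrderLE 0 a := ha.2

end PDO

namespace FinPDO

/-- The operator `∂ + q ∂^{-1} r`. -/
def finLax (q r : Fn K) : FinPDO K := D 1 + fn q * D (-1) * fn r

theorem val_finLax (q r : Fn K) : (finLax q r).1 = lax q r := rfl

theorem orderLE_integral_part (q r : Fn K) : OrderLE (-1) (fn q * D (-1) * fn r).1 :=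
  OrderLE.mono (A := 0 + -1 + 0) (((orderLE_ofFn q).mul (orderLE_dpow (-1))).mul (orderLE_ofFn r))
    (by simp)

/-- Only `[N, ∂]` contributes: products of `N` with `q ∂^{-1} r` have order at most `-2`. -/
theorem coeff_comm_finLax {N : FinPDO K} (hN : OrderLE (-1) N.1) (q r : Fn K) :
    (N * finLax q r - finLax q r * N).1.coeff (-1) = -pd 1 (N.1.coeff (-1)) := by
  have h1 : N * finLax q r - finLax q r * N =
      (N * D 1 - D 1 * N) + (N * (fn q * D (-1) * fn r) - (fn q * D (-1) * fn r) * N) := by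
    rw [finLax]; noncomm_ring
  have h2 := hN.mul (orderLE_integral_part q r) (-1) (by omega)
  have h3 := (orderLE_integral_part q r).mul hN (-1) (by omega)
  rw [h1, val_add, val_sub, val_sub, PDO.coeff_add, PDO.coeff_sub, PDO.coeff_sub]
  simp only [val_mul (K := K)] at h2 h3 ⊢
  rw [h2, h3, val_D, coeff_D_mul, coeff_mul_D]
  ring

end FinPDO

open FinPDO

theorem orderLE_lax (q r : Fn K) : OrderLE 1 (lax q r) :=
  ((orderLE_dpow 1).add (orderLE_integral_part q r)).mono (by simp)

theorem coeff_lax (q r : Fn K) (m : ℤ) :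
    (lax q r).coeff m = (if m = 1 then 1 else 0) + q * (dpow (-1) * ofFn r).coeff m := by
  have h : finLax q r = D 1 + fn q * (D (-1) * fn r) := by rw [finLax, mul_assoc]
  have h2 := congrArg (fun a => a.1.coeff m) h
  simp only [val_add, val_mul, val_fn, val_D, coeff_add, coeff_ofFn_mul, coeff_dpow] at h2
  exact h2

theorem coeff_lax_one (q r : Fn K) : (lax q r).coeff 1 = 1 := by
  rw [coeff_lax, (orderLE_dpow (-1)).mul (orderLE_ofFn r) 1 (by omega)]; simp

theorem coeff_lax_zero (q r : Fn K) : (lax q r).coeff 0 = 0 := by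
  rw [coeff_lax, (orderLE_dpow (-1)).mul (orderLE_ofFn r) 0 (by omega)]; simp

theorem coeff_lax_neg_one (q r : Fn K) : (lax q r).coeff (-1) = q * r := by
  rw [coeff_lax, coeff_dpow_mul (orderLE_ofFn r) (-1) (N := 1) (by simp)]
  simp [coeff_ofFn]

theorem exists_orderLE_opPow_lax (q r : Fn K) (n : ℕ) : ∃ A, OrderLE A (opPow (lax q r) n) := by
  rw [← val_finLax, ← val_pow]
  exact (finLax q r ^ n).2

/-! ### Consequences of the Lax equations -/

namespace IsSolution

variable {q r τ : Fn K} {W V : PDO K}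

/-- The residue of `L` is `q r`. As `L^n` commutes with `L`, the Lax bracket equals `-[(L^n)_-, L]`,
whose residue is known. -/
theorem pd_mul_eq (h : IsSolution q r W V τ) (n : ℕ+) :
    pd n (q * r) = pd 1 ((opPow (lax q r) n).coeff (-1)) := by
  obtain ⟨A, hA⟩ := exists_orderLE_opPow_lax q r n
  let P : FinPDO K := ⟨(opPow (lax q r) n).pos, A, hA.pos⟩
  let N : FinPDO K := ⟨(opPow (lax q r) n).neg, -1, orderLE_neg _⟩
  have hPN : P = finLax q r ^ (n : ℕ) - N := FinPDO.ext fun i => by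
    rw [val_sub, val_pow, coeff_sub]
    change (opPow (lax q r) n).pos.coeff i = (opPow (lax q r) n).coeff i -
      (opPow (lax q r) n).neg.coeff i
    rw [coeff_pos, coeff_negPart]
    split_ifs <;> first | omega | simp
  have h1 : P * finLax q r - finLax q r * P = -(N * finLax q r - finLax q r * N) := by
    rw [hPN, sub_mul, mul_sub, ← pow_succ, ← pow_succ']
    abel
  have h2 : (lax q r).tderiv n = (P * finLax q r - finLax q r * P).1 := h.lax_eq n
  have h3 := congrArg (fun a : PDO K => a.coeff (-1)) h2
  have h4 : (opPow (lax q r) n).neg.coeff (-1) = (opPow (lax q r) n).coeff (-1) := by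
    rw [coeff_negPart, if_pos (by omega)]
  rw [h1, val_neg, coeff_neg, coeff_comm_finLax (orderLE_neg _), neg_neg] at h3
  rw [← coeff_lax_neg_one]
  exact h3.trans (congrArg (pd 1) h4)

theorem opPow_lax (h : IsSolution q r W V τ) (n : ℕ) :
    opPow (lax q r) n = W * dpow n * V := by
  let w : FinPDO K := ⟨W, 0, h.monic.orderLE⟩
  let v : FinPDO K := ⟨V, 0, h.monic_inv.orderLE⟩
  have hvw : v * w = 1 := FinPDO.val_ext h.inv_mul
  have hwv : w * v = 1 := FinPDO.val_ext h.mul_inv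
  have hL : finLax q r = w * D 1 * v := FinPDO.val_ext h.dressing
  have key : finLax q r ^ n = w * D n * v := by
    induction n with
    | zero => rw [pow_zero, Nat.cast_zero, D_zero, mul_one, hwv]
    | succ n ih =>
      rw [pow_succ, ih, hL, D_natCast, D_natCast, pow_succ]
      calc _ = w * D 1 ^ n * (v * w) * D 1 * v := by simp only [mul_assoc]
        _ = _ := by rw [hvw]; simp only [mul_assoc, one_mul]
  rw [← val_finLax, ← val_pow, key]
  rfl

/-- The contribution of `t_{l+1}` to the Orlov-Schulman operator. -/
theorem dressed_time_succ (h : IsSolution q r W V τ) (c : ℕ+ →₀ K) (l : ℕ+) (i : ℤ) :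
    (W * (ofFn ((((l + 1 : ℕ+) : ℕ) : Fn K) * time c (l + 1)) *
      dpow (((l + 1 : ℕ+) : ℤ) - 1)) * V).coeff i =
      ((l : ℕ) + 1 : Fn K) * time c (l + 1) * (opPow (lax q r) l).coeff i := by
  let w : FinPDO K := ⟨W, 0, h.monic.orderLE⟩
  let v : FinPDO K := ⟨V, 0, h.monic_inv.orderLE⟩
  have hc : pd 1 (((l : ℕ) + 1 : Fn K) * time c (l + 1)) = 0 := by
    rw [pd_mul, pd_time_of_ne c (succ_ne_one l), pd_add, pd_natCast, pd_one]
    ring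
  have h1 : w * (fn (((l : ℕ) + 1 : Fn K) * time c (l + 1)) * D (l : ℕ)) * v =
      fn (((l : ℕ) + 1 : Fn K) * time c (l + 1)) * (w * D (l : ℕ) * v) := by
    rw [← mul_assoc, mul_fn_of_const hc]
    simp only [mul_assoc]
  have h2 := congrArg (fun a => a.1.coeff i) h1
  rw [val_mul (fn _), val_fn, coeff_ofFn_mul] at h2
  rw [h.opPow_lax]
  have e1 : (((l + 1 : ℕ+) : ℕ) : Fn K) = (l : ℕ) + 1 := by push_cast; rfl
  have e2 : ((l + 1 : ℕ+) : ℤ) - 1 = ((l : ℕ) : ℤ) := by push_cast; ring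
  rw [e1, e2]
  exact h2

/-- The contribution of `x` to the Orlov-Schulman operator, up to operators of order `-2`. -/
theorem dressed_time_one (h : IsSolution q r W V τ) (c : ℕ+ →₀ K) {i : ℤ} (hi : -1 ≤ i) :
    (W * (ofFn ((((1 : ℕ+) : ℕ) : Fn K) * time c 1) * dpow (((1 : ℕ+) : ℤ) - 1)) * V).coeff i =
      if i = 0 then time c 1 else 0 := by
  let w : FinPDO K := ⟨W, 0, h.monic.orderLE⟩
  let v : FinPDO K := ⟨V, 0, h.monic_inv.orderLE⟩
  have hwv : w * v = 1 := FinPDO.val_ext h.mul_inv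
  -- The coefficient of `∂^m` in `[W, x]` is `(m+1) w_{m+1}` (here `w_i` multiplies `∂^i`): the
  -- factor kills `m = -1`, and `W` has no positive powers.
  have hord : OrderLE (-2) (w * fn (time c 1) - fn (time c 1) * w).1 := by
    intro m hm
    rw [val_sub, coeff_sub, val_mul, val_mul, val_fn, coeff_ofFn_mul]
    change (W * ofFn (time c 1)).coeff m - time c 1 * W.coeff m = 0
    rw [coeff_mul, csum_eq_sum {(m, 0), (m + 1, 1)}, Finset.sum_pair (by simp)]
    · have hW : (m + 1) • W.coeff (m + 1) = 0 := by
        by_cases hm' : m = -1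
        · rw [hm', neg_add_cancel, zero_smul]
        · rw [h.monic.2 (m + 1) (by omega), smul_zero]
      simp only [Ring.choose_zero_right, Ring.choose_one_right, coeff_ofFn, one_smul]
      rw [if_pos (by simp), if_pos (by simp), Function.iterate_one, pd_time_self, mul_one, hW,
        Function.iterate_zero, id]
      ring
    · rintro ⟨j, k⟩ hjk
      simp only [Finset.mem_insert, Finset.mem_singleton, Prod.mk.injEq, not_or, not_and] at hjk
      dsimp only
      rw [coeff_ofFn]
      split_ifs with hk
      · match k with
        | 0 => exact absurd rfl (hjk.1 (by push_cast at hk; omega))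
        | 1 => exact absurd rfl (hjk.2 (by push_cast at hk; omega))
        | k + 2 =>
          rw [Function.iterate_succ_apply, Function.iterate_succ_apply, pd_time_self, pd_one,
            pd_iterate_zero, mul_zero, smul_zero]
      · rw [pd_iterate_zero, mul_zero, smul_zero]
  have h1 : w * (fn (time c 1) * D 0) * v =
      fn (time c 1) + (w * fn (time c 1) - fn (time c 1) * w) * v := by
    rw [D_zero, mul_one, sub_mul, mul_assoc (fn _), hwv, mul_one]
    abel
  have h2 := congrArg (fun a => a.1.coeff i) h1
  have hz : ((w * fn (time c 1) - fn (time c 1) * w) * v).1.coeff i = 0 :=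
    hord.mul h.monic_inv.orderLE i (by omega)
  rw [val_add, coeff_add, hz, add_zero] at h2
  have e1 : (((1 : ℕ+) : ℕ) : Fn K) * time c 1 = time c 1 := by simp
  have e2 : ((1 : ℕ+) : ℤ) - 1 = 0 := by simp
  rw [e1, e2]
  exact h2

theorem orlovSchulman_cong (h : IsSolution q r W V τ) {c : ℕ+ →₀ K} {F : Finset ℕ+}
    (hc : c.support ⊆ F) {i : ℤ} (hi : -1 ≤ i) :
    Cong F ((orlovSchulman c W V).coeff i) ((if i = 0 then time c 1 else 0) +
      ∑ l ∈ predSet F, ((l : ℕ) + 1 : Fn K) * time c (l + 1) * (opPow (lax q r) l).coeff i) := by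
  classical
  refine (Cong.csum_sum (insert 1 ((predSet F).image (· + 1))) fun l hl => ?_).trans
    (Cong.of_eq ?_)
  · simp only [Finset.mem_insert, Finset.mem_image, mem_predSet, not_or, not_exists, not_and] at hl
    obtain ⟨m, rfl⟩ := PNat.exists_eq_succ_of_ne_one hl.1
    rw [h.dressed_time_succ]
    simpa using ((Cong.refl F ((m : ℕ) + 1 : Fn K)).mul
      (cong_time_zero hc fun hm => hl.2 m hm rfl)).mul
      (Cong.refl F ((opPow (lax q r) m).coeff i))
  · rw [Finset.sum_insert, Finset.sum_image (fun _ _ _ _ h => add_right_cancel h),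
      h.dressed_time_one c hi]
    · exact congrArg _ (Finset.sum_congr rfl fun l _ => h.dressed_time_succ c l i)
    · simp only [Finset.mem_image, not_exists, not_and]
      exact fun l _ => succ_ne_one l

theorem pd_coeff_orlovSchulman {c : ℕ+ →₀ K} (hL : addFlowLax c W V q r = ofFn 0) :
    pd 1 ((orlovSchulman c W V).coeff (-1)) = 0 := by
  let N : FinPDO K := ⟨-(orlovSchulman c W V).neg, -1, (orderLE_neg _).neg⟩
  have h1 : N * finLax q r - finLax q r * N = 0 := FinPDO.val_ext hL
  have h2 := coeff_comm_finLax (N := N) (orderLE_neg _).neg q r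
  rw [h1, FinPDO.coeff_zero] at h2
  change 0 = -pd 1 ((-(orlovSchulman c W V).neg).coeff (-1)) at h2
  rw [coeff_neg, coeff_negPart, if_pos (by omega), pd_neg, neg_neg] at h2
  exact h2.symm

/-- Modulo `F`, `S(qr)` is `∂_x` of the residue of `M`, which the invariance of `L` makes zero. -/
theorem stringD_mul_eq_zero (h : IsSolution q r W V τ) {c : ℕ+ →₀ K}
    (hL : addFlowLax c W V q r = ofFn 0) : stringD c (q * r) = 0 := by
  refine eq_of_cong (insert 1 c.support) fun F hF => ?_
  have hF' := (Finset.subset_insert _ _).trans hF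
  have h1 : (1 : ℕ+) ∈ F := hF (Finset.mem_insert_self _ _)
  have h2 := (h.orlovSchulman_cong hF' (le_refl (-1))).pd h1
  rw [pd_coeff_orlovSchulman hL, if_neg (by omega), zero_add, pd_sum] at h2
  refine ((stringD_cong hF' _).trans (Cong.of_eq ?_)).trans h2.symm
  refine Finset.sum_congr rfl fun l _ => ?_
  have hc : pd 1 (((l : ℕ) + 1 : Fn K) * time c (l + 1)) = 0 := by
    rw [pd_mul, pd_time_of_ne c (succ_ne_one l), pd_add, pd_natCast, pd_one]
    ring
  rw [h.pd_mul_eq, pd_mul, hc, zero_mul, add_zero]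

end IsSolution

/-! ### The adjoint action -/

theorem adj_cong {F : Finset ℕ+} (hF : 1 ∈ F) {a b : PDO K}
    (h : ∀ i, Cong F (a.coeff i) (b.coeff i)) (i : ℤ) :
    Cong F (a.adj.coeff i) (b.adj.coeff i) :=
  Cong.csum fun k => ((h _).pd_iterate hF k).zsmul _

theorem act_cong {F : Finset ℕ+} {a b : PDO K} (h : ∀ i, Cong F (a.coeff i) (b.coeff i))
    (f : Fn K) : Cong F (a.act f) (b.act f) :=
  Cong.csum fun _ => (h _).mul (Cong.refl _ _)

theorem coeff_adj_eq_sum {a : PDO K} {m : ℤ} {N : ℕ} (ha : OrderLE (m + N) a) :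
    a.adj.coeff m = ∑ k ∈ Finset.range (N + 1),
      (((m + k).negOnePow : ℤ) * Ring.choose (m + k) k) • (pd 1)^[k] (a.coeff (m + k)) := by
  refine csum_eq_sum _ fun k hk => ?_
  rw [Finset.mem_range, not_lt] at hk
  rw [ha _ (by omega), pd_iterate_zero, smul_zero]

theorem orderLE_adj {A : ℤ} {a : PDO K} (ha : OrderLE A a) : OrderLE A a.adj := fun i hi => by
  refine (csum_eq_sum ∅ fun k _ => ?_).trans Finset.sum_empty
  rw [ha _ (by omega), pd_iterate_zero, smul_zero]

theorem act_eq_sum {a : PDO K} {N : ℕ} (ha : OrderLE N a) (f : Fn K) :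
    a.act f = ∑ i ∈ Finset.range (N + 1), a.coeff i * (pd 1)^[i] f := by
  refine csum_eq_sum _ fun k hk => ?_
  rw [Finset.mem_range, not_lt] at hk
  rw [ha _ (by omega), zero_mul]

theorem adj_act_eq_sum {a : PDO K} {N : ℕ} (ha : OrderLE N a) (f : Fn K) :
    a.adj.act f = ∑ m ∈ Finset.range (N + 1), (∑ k ∈ Finset.range (N + 1),
      ((((m : ℤ) + k).negOnePow : ℤ) * Ring.choose ((m : ℤ) + k) k) •
        (pd 1)^[k] (a.coeff (m + k))) * (pd 1)^[m] f := by
  rw [act_eq_sum (orderLE_adj ha)]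
  exact Finset.sum_congr rfl fun m _ => by
    rw [coeff_adj_eq_sum (N := N) (ha.mono (by omega))]

theorem adj_act_ofFn (g f : Fn K) : (ofFn g).adj.act f = g * f := by
  rw [adj_act_eq_sum (N := 0) (orderLE_ofFn g)]
  simp [coeff_ofFn]

theorem adj_act_add {a b : PDO K} {A B : ℤ} (ha : OrderLE A a) (hb : OrderLE B b) (f : Fn K) :
    (a + b).adj.act f = a.adj.act f + b.adj.act f := by
  obtain ⟨N, hA, hB⟩ : ∃ N : ℕ, A ≤ N ∧ B ≤ N := ⟨(max A B).toNat, by omega, by omega⟩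
  rw [adj_act_eq_sum (ha.mono hA), adj_act_eq_sum (hb.mono hB),
    adj_act_eq_sum ((ha.add hb).mono (max_le hA hB)), ← Finset.sum_add_distrib]
  refine Finset.sum_congr rfl fun m _ => ?_
  rw [← add_mul, ← Finset.sum_add_distrib]
  congr 1
  refine Finset.sum_congr rfl fun k _ => ?_
  rw [coeff_add, pd_iterate_add, smul_add]

/-- A factor constant in `x` passes through every `(-∂)^i`. With additivity this is all that is
needed to conjugate `M_+`, so no general rule for `(ab)^*` is required. -/
theorem adj_act_ofFn_mul {g : Fn K} (hg : pd 1 g = 0) {a : PDO K} {A : ℤ} (ha : OrderLE A a)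
    (f : Fn K) : (ofFn g * a).adj.act f = g * a.adj.act f := by
  obtain ⟨N, hN⟩ : ∃ N : ℕ, A ≤ N := ⟨A.toNat, by omega⟩
  rw [adj_act_eq_sum (ha.mono hN),
    adj_act_eq_sum (((orderLE_ofFn g).mul ha).mono (by omega : 0 + A ≤ N)), Finset.mul_sum]
  refine Finset.sum_congr rfl fun m _ => ?_
  rw [← mul_assoc, Finset.mul_sum]
  congr 1
  refine Finset.sum_congr rfl fun k _ => ?_
  rw [coeff_ofFn_mul, pd_iterate_mul_of_const _ _ hg, mul_smul_comm]

theorem adj_act_sum {ι : Type*} (s : Finset ι) (a : ι → FinPDO K) (f : Fn K) :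
    (∑ i ∈ s, a i).1.adj.act f = ∑ i ∈ s, (a i).1.adj.act f := by
  classical
  induction s using Finset.induction_on with
  | empty =>
    rw [Finset.sum_empty, Finset.sum_empty, ← fn_zero, val_fn, adj_act_ofFn, zero_mul]
  | insert i s hi ih =>
    obtain ⟨_, hA⟩ := (a i).2
    obtain ⟨_, hB⟩ := (∑ i ∈ s, a i).2
    rw [Finset.sum_insert hi, Finset.sum_insert hi, val_add, adj_act_add hA hB, ih]

theorem FinPDO.coeff_sum {ι : Type*} (s : Finset ι) (a : ι → FinPDO K) (j : ℤ) :
    (∑ i ∈ s, a i).1.coeff j = ∑ i ∈ s, (a i).1.coeff j := by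
  classical
  induction s using Finset.induction_on with
  | empty => rw [Finset.sum_empty, Finset.sum_empty, FinPDO.coeff_zero]
  | insert i s hi ih =>
    rw [Finset.sum_insert hi, Finset.sum_insert hi, val_add, PDO.coeff_add, ih]

/-! ### Weights of `r` and `q` under the string operator -/

namespace IsSolution

variable {q r τ : Fn K} {W V : PDO K}

theorem stringD_right (h : IsSolution q r W V τ) {c : ℕ+ →₀ K}
    (hr : addFlowAdj c W V r = 0) : stringD c r = time c 1 * r := by
  refine eq_of_cong (insert 1 c.support) fun F hF => ?_
  have hF' := (Finset.subset_insert _ _).trans hF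
  have h1 : (1 : ℕ+) ∈ F := hF (Finset.mem_insert_self _ _)
  have hB : ∀ l : ℕ+, ∃ A, OrderLE A (laxB q r l) := fun l =>
    let ⟨A, hA⟩ := exists_orderLE_opPow_lax q r l; ⟨A, hA.pos⟩
  let b : ℕ+ → FinPDO K := fun l =>
    fn (((l : ℕ) + 1 : Fn K) * time c (l + 1)) * ⟨laxB q r l, hB l⟩
  have hc : ∀ l : ℕ+, pd 1 (((l : ℕ) + 1 : Fn K) * time c (l + 1)) = 0 := fun l => by
    rw [pd_mul, pd_time_of_ne c (succ_ne_one l), pd_add, pd_natCast, pd_one]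
    ring
  -- `M_+` has infinite order, but modulo `F` it is `x` plus finitely many multiples of `B_l`.
  have hcong : ∀ i, Cong F ((orlovSchulman c W V).pos.coeff i)
      ((fn (time c 1) + ∑ l ∈ predSet F, b l).1.coeff i) := by
    intro i
    have hb : ∀ l, (b l).1.coeff i =
        ((l : ℕ) + 1 : Fn K) * time c (l + 1) * (laxB q r l).coeff i := fun l => by
      simp only [b]
      rw [val_mul, val_fn, coeff_ofFn_mul]
    rw [val_add, coeff_add, FinPDO.coeff_sum, val_fn, coeff_ofFn]
    simp only [hb, laxB, coeff_pos]
    by_cases hi : 0 ≤ i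
    · simp only [if_pos hi]
      exact h.orlovSchulman_cong hF' (by omega)
    · simp only [if_neg hi, mul_zero, Finset.sum_const_zero, add_zero]
      rw [if_neg (by omega)]
      exact Cong.refl _ _
  have h2 := act_cong (adj_cong h1 hcong) r
  obtain ⟨_, hs⟩ := (∑ l ∈ predSet F, b l).2
  have h3 : (orlovSchulman c W V).pos.adj.act r = 0 := neg_eq_zero.1 hr
  have h4 : ∀ l, (b l).1.adj.act r =
      -(((l : ℕ) + 1 : Fn K) * time c (l + 1) * pd l r) := fun l => by
    obtain ⟨_, hl⟩ := hB l
    simp only [b]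
    rw [val_mul, val_fn, adj_act_ofFn_mul (hc l) hl, h.adjoint_eigen]
    ring
  rw [h3, val_add, val_fn, adj_act_add (orderLE_ofFn _) hs, adj_act_ofFn, adj_act_sum] at h2
  simp only [h4, Finset.sum_neg_distrib] at h2
  have h5 := h2.add (stringD_cong hF' r)
  rw [zero_add, neg_add_cancel_right] at h5
  exact h5

theorem stringD_left (h : IsSolution q r W V τ) {c : ℕ+ →₀ K}
    (hL : addFlowLax c W V q r = ofFn 0) (hr : addFlowAdj c W V r = 0) (hu : IsUnit r) :
    stringD c q = -(time c 1 * q) := by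
  have h1 := h.stringD_mul_eq_zero hL
  rw [stringD_mul, h.stringD_right hr] at h1
  refine hu.mul_right_cancel ?_
  linear_combination h1

end IsSolution

/-! ### Inverses of power series -/

theorem mul_inv_of_isUnit {f : Fn K} (hf : IsUnit f) : f * f⁻¹ = 1 :=
  MvPowerSeries.mul_inv_cancel f (MvPowerSeries.isUnit_iff_constantCoeff.1 hf).ne_zero

theorem pd_inv {f : Fn K} (hf : IsUnit f) (l : ℕ+) : f * pd l f⁻¹ = -(pd l f * f⁻¹) := by
  have := congrArg (pd l) (mul_inv_of_isUnit hf)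
  rw [pd_mul, pd_one] at this
  linear_combination this

/-! ### Gauge transformations of integral type -/

/-- The adjoint eigenfunction after one gauge transformation, `r_xx - r_x² / r + q r²`. -/
def nextR (q r : Fn K) : Fn K := pd 1 (pd 1 r) + r * pd 1 r⁻¹ * pd 1 r + q * r * r

/-- Here `T_D(r) = ∂ + r (1/r)_x` and `L^* = -∂ - q r ∂^{-1} + …`, so three coefficients of `L^*`
determine the action on `r`. -/
theorem gauge_act_eq_nextR {q r : Fn K} (hr : IsUnit r) :
    -(gaugeD r * (lax q r).adj).act r = nextR q r := by
  have hA : OrderLE 1 (lax q r).adj := orderLE_adj (orderLE_lax q r)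
  have h1 : (lax q r).adj.coeff 1 = -1 := by
    rw [coeff_adj_eq_sum (N := 0) (orderLE_lax q r)]
    simp [coeff_lax_one]
  have h0 : (lax q r).adj.coeff 0 = 0 := by
    rw [coeff_adj_eq_sum (N := 1) (orderLE_lax q r)]
    simp [Finset.sum_range_succ, coeff_lax_zero, coeff_lax_one]
  have hn : (lax q r).adj.coeff (-1) = -(q * r) := by
    rw [coeff_adj_eq_sum (N := 2) (by exact orderLE_lax q r)]
    simp [Finset.sum_range_succ, coeff_lax_zero, coeff_lax_one, coeff_lax_neg_one]
  let a : FinPDO K := ⟨(lax q r).adj, 1, hA⟩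
  have hg : fn r * D 1 * fn r⁻¹ * a = D 1 * a + fn (r * pd 1 r⁻¹) * a := by
    have : fn r * D 1 * fn r⁻¹ = D 1 + fn (r * pd 1 r⁻¹) := by
      rw [mul_assoc, D_one_mul_fn, mul_add, ← mul_assoc, ← fn_mul, ← fn_mul,
        mul_inv_of_isUnit hr, fn_one, one_mul]
    rw [this, add_mul]
  have hm : ∀ m, (gaugeD r * (lax q r).adj).coeff m = (lax q r).adj.coeff (m - 1) +
      pd 1 ((lax q r).adj.coeff m) + r * pd 1 r⁻¹ * (lax q r).adj.coeff m := fun m => by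
    have h2 := congrArg (fun x => x.1.coeff m) hg
    simp only [val_add, val_mul _ a, val_fn, val_D, coeff_add, coeff_D_mul, coeff_ofFn_mul] at h2
    exact h2
  have hord : OrderLE (2 : ℕ) (gaugeD r * (lax q r).adj) := fun i hi => by
    push_cast at hi
    rw [hm, hA _ (by omega), hA _ (by omega)]
    simp
  rw [act_eq_sum hord]
  simp only [Finset.sum_range_succ, Finset.sum_range_zero, hm]
  push_cast
  rw [hn, h0, h1, hA 2 (by norm_num), pd_neg, pd_one, pd_zero,
    Function.iterate_zero, id, Function.iterate_one, Function.iterate_succ_apply,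
    Function.iterate_one, nextR]
  ring

theorem lax_gauge {q r : Fn K} (hr : IsUnit r) :
    lax r⁻¹ (nextR q r) = gaugeI r * lax q r * gaugeIInv r := by
  have hinv := mul_inv_of_isUnit hr
  have hinv' : r⁻¹ * r = 1 := by rw [mul_comm, hinv]
  have e0 : fn r * fn r⁻¹ = 1 := by rw [← fn_mul, hinv, fn_one]
  have e1 : fn r⁻¹ * fn r = 1 := by rw [← fn_mul, hinv', fn_one]
  have e2 : fn r⁻¹ * D 1 * fn r = D 1 + fn (r⁻¹ * pd 1 r) := by
    rw [mul_assoc, D_one_mul_fn, mul_add, ← mul_assoc, e1, one_mul, fn_mul]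
  have hn : nextR q r = r * pd 1 (r⁻¹ * pd 1 r) + r * q * r := by
    rw [nextR, pd_mul]
    linear_combination (-(pd 1 (pd 1 r))) * hinv
  -- The right gauge factor cancels the `∂^{-1}` of `L`, leaving a differential operator; `r⁻¹
  -- ∂^{-1}` is put back on the left afterwards.
  have e3 : fn r * (D 1 + fn q * D (-1) * fn r) * (fn r⁻¹ * D 1 * fn r) =
      D 1 * fn r * D 1 + fn (nextR q r) := by
    have e4 : fn q * D (-1) * fn r * (fn r⁻¹ * D 1 * fn r) = fn q * fn r := by
      calc _ = fn q * D (-1) * (fn r * fn r⁻¹) * D 1 * fn r := by simp only [mul_assoc]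
        _ = fn q * (D (-1) * D 1) * fn r := by rw [e0, mul_one]; simp only [mul_assoc]
        _ = _ := by rw [D_neg_one_mul, mul_one]
    rw [mul_assoc, add_mul, e4, e2, mul_add, mul_add, D_one_mul_fn, mul_add, mul_add,
      D_one_mul_fn r, add_mul, hn, fn_add, fn_mul r (pd 1 _), fn_mul (r * q), fn_mul r q]
    have e5 : pd 1 r = r * (r⁻¹ * pd 1 r) := by rw [← mul_assoc, hinv, one_mul]
    have e6 : fn (pd 1 r) = fn r * fn (r⁻¹ * pd 1 r) := by rw [← fn_mul, ← e5]
    rw [e6]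
    simp only [mul_assoc, add_assoc]
  have key : finLax r⁻¹ (nextR q r) =
      fn r⁻¹ * D (-1) * fn r * finLax q r * (fn r⁻¹ * D 1 * fn r) := by
    calc finLax r⁻¹ (nextR q r) = fn r⁻¹ * D (-1) * (D 1 * fn r * D 1 + fn (nextR q r)) := by
          rw [finLax, mul_add]
          congr 1
          calc D 1 = fn r⁻¹ * fn r * D 1 := by rw [e1, one_mul]
            _ = fn r⁻¹ * (D (-1) * D 1) * fn r * D 1 := by rw [D_neg_one_mul, mul_one]
            _ = _ := by simp only [mul_assoc]
      _ = _ := by rw [← e3, finLax]; simp only [mul_assoc]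
  exact congrArg FinPDO.val key

theorem gaugeR_zero (q r : Fn K) : gaugeR q r 0 = r := rfl

theorem gaugeQR_succ {q r : Fn K} {k : ℕ} (h : IsUnit (gaugeR q r k)) :
    gaugeQR q r (k + 1) = ((gaugeR q r k)⁻¹, nextR (gaugeQR q r k).1 (gaugeR q r k)) := by
  rw [← gauge_act_eq_nextR h]
  rfl

/-- Peels off the first gauge step rather than the last, as the Wronskian induction requires. -/
theorem gaugeQR_succ_eq (q r : Fn K) (k : ℕ) :
    gaugeQR q r (k + 1) = gaugeQR (gaugeQR q r 1).1 (gaugeQR q r 1).2 k := by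
  induction k with
  | zero => rfl
  | succ k ih => rw [gaugeQR, ih]; rfl

theorem gaugeTau_eq_prod (q r τ : Fn K) (n : ℕ) :
    gaugeTau q r τ n = (∏ k ∈ Finset.range n, gaugeR q r k) * τ := by
  induction n with
  | zero => rw [gaugeTau, Finset.range_zero, Finset.prod_empty, one_mul]
  | succ n ih => rw [gaugeTau, ih, Finset.prod_range_succ]; ring

/-! ### The string equation -/

theorem stringD_inv {c : ℕ+ →₀ K} {r x : Fn K} (hr : IsUnit r) (h : stringD c r = x * r) :
    stringD c r⁻¹ = -(x * r⁻¹) := by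
  have h1 := congrArg (stringD c) (mul_inv_of_isUnit hr)
  rw [stringD_mul, stringD_one, h] at h1
  refine hr.mul_left_cancel ?_
  linear_combination h1

/-- Each term has total weight `1`. Differentiating `x` adds `2 r_x` from `r_xx` and `-2 r_x` from
the quadratic term, and these cancel. -/
theorem stringD_nextR {c : ℕ+ →₀ K} {q r : Fn K} (hu : IsUnit r)
    (hq : stringD c q = -(time c 1 * q)) (hr : stringD c r = time c 1 * r) :
    stringD c (nextR q r) = time c 1 * nextR q r := by
  have hx := pd_time_self c 1
  have h1 : stringD c (pd 1 r) = time c 1 * pd 1 r + r := by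
    rw [stringD_pd, hr, pd_mul, hx, one_mul]
  have h2 : stringD c (pd 1 (pd 1 r)) = time c 1 * pd 1 (pd 1 r) + 2 * pd 1 r := by
    rw [stringD_pd, h1, pd_add, pd_mul, hx]
    ring
  have h3 : stringD c (pd 1 r⁻¹) = -(time c 1 * pd 1 r⁻¹ + r⁻¹) := by
    rw [stringD_pd, stringD_inv hu hr, pd_neg, pd_mul, hx, one_mul]
  rw [nextR, stringD_add, stringD_add, stringD_mul, stringD_mul, stringD_mul, stringD_mul,
    h1, h2, h3, hq, hr]
  linear_combination r * pd_inv hu 1 - 2 * pd 1 r * mul_inv_of_isUnit hu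

theorem stringD_gaugeQR {c : ℕ+ →₀ K} {q r : Fn K}
    (hq : stringD c q = -(time c 1 * q)) (hr : stringD c r = time c 1 * r) (k : ℕ)
    (hu : ∀ j < k, IsUnit (gaugeR q r j)) :
    stringD c (gaugeQR q r k).1 = -(time c 1 * (gaugeQR q r k).1) ∧
      stringD c (gaugeR q r k) = time c 1 * gaugeR q r k := by
  induction k with
  | zero => exact ⟨hq, hr⟩
  | succ k ih =>
    obtain ⟨h1, h2⟩ := ih fun j hj => hu j (by omega)
    have huk := hu k (by omega)
    rw [gaugeR, gaugeQR_succ huk]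
    exact ⟨stringD_inv huk h2, stringD_nextR huk h1 h2⟩

theorem stringD_prod_gaugeR {c : ℕ+ →₀ K} {q r : Fn K}
    (hq : stringD c q = -(time c 1 * q)) (hr : stringD c r = time c 1 * r) (n : ℕ)
    (hu : ∀ j < n, IsUnit (gaugeR q r j)) :
    stringD c (∏ k ∈ Finset.range n, gaugeR q r k) =
      (n : Fn K) * time c 1 * ∏ k ∈ Finset.range n, gaugeR q r k := by
  induction n with
  | zero => simp
  | succ n ih =>
    have hu' : ∀ j < n, IsUnit (gaugeR q r j) := fun j hj => hu j (by omega)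
    rw [Finset.prod_range_succ, stringD_mul, ih hu', (stringD_gaugeQR hq hr n hu').2]
    push_cast
    ring

/-! ### Wronskians -/

/-- The coefficients of the operator `∂^i ∘ g`. -/
def leibnizCoeff (g : Fn K) : ℕ → ℕ → Fn K
  | 0, 0 => g
  | 0, _ + 1 => 0
  | i + 1, 0 => pd 1 (leibnizCoeff g i 0)
  | i + 1, l + 1 => pd 1 (leibnizCoeff g i (l + 1)) + leibnizCoeff g i l

theorem leibnizCoeff_of_lt (g : Fn K) (i l : ℕ) (h : i < l) : leibnizCoeff g i l = 0 := by
  induction i generalizing l with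
  | zero =>
    cases l with
    | zero => omega
    | succ l => rfl
  | succ i ih =>
    cases l with
    | zero => omega
    | succ l => rw [leibnizCoeff, ih _ (by omega), ih _ (by omega), pd_zero, add_zero]

theorem leibnizCoeff_self (g : Fn K) (i : ℕ) : leibnizCoeff g i i = g := by
  induction i with
  | zero => rfl
  | succ i ih => rw [leibnizCoeff, leibnizCoeff_of_lt g i (i + 1) (by omega), pd_zero, zero_add, ih]

theorem pd_iterate_mul (g f : Fn K) {i n : ℕ} (hi : i < n) :
    (pd 1)^[i] (g * f) = ∑ l ∈ Finset.range n, leibnizCoeff g i l * (pd 1)^[l] f := by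
  induction i with
  | zero =>
    rw [Finset.sum_eq_single_of_mem 0 (Finset.mem_range.2 hi)]
    · rfl
    · intro l _ hl
      rw [leibnizCoeff_of_lt g 0 l (by omega), zero_mul]
  | succ i ih =>
    obtain ⟨m, rfl⟩ : ∃ m, n = m + 1 := ⟨n - 1, by omega⟩
    rw [Function.iterate_succ_apply', ih (by omega), pd_sum]
    simp only [pd_mul, ← Function.iterate_succ_apply' (pd 1)]
    rw [Finset.sum_add_distrib, Finset.sum_range_succ, leibnizCoeff_of_lt g i m (by omega),
      zero_mul, add_zero, Finset.sum_range_succ' (fun l => pd 1 _ * _),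
      Finset.sum_range_succ' (fun l => leibnizCoeff g (i + 1) l * _), ← add_assoc,
      ← Finset.sum_add_distrib]
    refine congrArg₂ _ (Finset.sum_congr rfl fun l _ => ?_) rfl
    rw [leibnizCoeff]
    ring

/-- The matrices differ by a left factor that is lower triangular with `g` on the diagonal. -/
theorem wronskian_mul {n : ℕ} (g : Fn K) (f : Fin n → Fn K) :
    wronskian (fun j => g * f j) = g ^ n * wronskian f := by
  have h : (Matrix.of fun i j : Fin n => (pd 1)^[(i : ℕ)] (g * f j)) =
      (Matrix.of fun i l : Fin n => leibnizCoeff g i l) *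
        Matrix.of fun i j : Fin n => (pd 1)^[(i : ℕ)] (f j) := by
    ext1 i j
    rw [Matrix.mul_apply, Matrix.of_apply, pd_iterate_mul g (f j) i.2, Finset.sum_range]
    rfl
  have hdet : (Matrix.of fun i l : Fin n => leibnizCoeff g i l).det = g ^ n := by
    rw [Matrix.det_of_isLowerTriangular]
    · simp [leibnizCoeff_self]
    · intro i j hij
      exact leibnizCoeff_of_lt g i j hij
  rw [wronskian, h, Matrix.det_mul, hdet, wronskian]

theorem wronskian_last_one {n : ℕ} (f : Fin (n + 1) → Fn K) (hf : f (Fin.last n) = 1) :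
    wronskian f = (-1) ^ n * wronskian fun j : Fin n => pd 1 (f j.castSucc) := by
  rw [wronskian, Matrix.det_succ_column _ (Fin.last n), Fin.sum_univ_succ,
    Finset.sum_eq_zero, add_zero]
  · rw [Matrix.of_apply, hf, Fin.val_zero, Function.iterate_zero, id, mul_one, Fin.val_last,
      zero_add, wronskian]
    congr 2
    ext1 i j
    simp only [Matrix.submatrix_apply, Matrix.of_apply, Fin.succAbove_zero, Fin.succAbove_last,
      Fin.val_succ, Function.iterate_succ_apply]
  · intro i _
    rw [Matrix.of_apply, hf, Fin.val_succ, Function.iterate_succ_apply, pd_one, pd_iterate_zero,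
      mul_zero, zero_mul]

/-- The gauge transformation maps a chain of values of `L^*` to a shorter one. -/
theorem IsLaxAdjValue.gauge {q r f g : Fn K} (hu : IsUnit r) (h : IsLaxAdjValue q r f g) :
    IsLaxAdjValue r⁻¹ (nextR q r) (-r * pd 1 (r⁻¹ * f)) (-r * pd 1 (r⁻¹ * g)) := by
  obtain ⟨φ, hφ, rfl⟩ := h
  have hinv := mul_inv_of_isUnit hu
  obtain ⟨u, rfl⟩ : ∃ u, f = r * u := ⟨r⁻¹ * f, by rw [← mul_assoc, hinv, one_mul]⟩
  have e1 : r⁻¹ * (r * u) = u := by rw [← mul_assoc, mul_comm r⁻¹, hinv, one_mul]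
  have e2 : r⁻¹ * (-pd 1 (r * u) - r * φ) = -(pd 1 u) + (r * pd 1 r⁻¹) * u - φ := by
    rw [pd_mul]
    linear_combination (-(pd 1 u) - φ) * hinv - u * pd_inv hu 1
  -- With `f = r u`, the new `q` times the transformed `f` is `r⁻¹ (-r u_x) = -u_x`, whose
  -- antiderivative is explicit.
  refine ⟨-u, ?_, ?_⟩
  · rw [e1, pd_neg]
    linear_combination (pd 1 u) * hinv
  · have e3 := pd_inv hu 1
    have e4 : r * (r * pd 1 r⁻¹) = -pd 1 r := by
      linear_combination r * e3 - pd 1 r * hinv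
    have e5 := congrArg (pd 1) e4
    simp only [pd_mul, pd_neg] at e5
    rw [e1, e2, nextR]
    simp only [pd_sub, pd_add, pd_neg, pd_mul, hφ]
    linear_combination -u * e5 - pd 1 u * e4

/-- The map `f ↦ -r (f/r)_x` carries `η_1, η_2, …` to a chain for the gauged pair starting at its
new `r`. Changing an antiderivative in `L^*` adds to the value an `x`-constant multiple of `r`,
which this map kills. -/
theorem wronskian_eq_prod_gaugeR (n : ℕ) (q r : Fn K) (η : ℕ → Fn K)
    (hunit : ∀ k < n, IsUnit (gaugeR q r k)) (h0 : η 0 = r)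
    (hη : ∀ k, k + 1 < n → IsLaxAdjValue q r (η k) (η (k + 1))) :
    wronskian (fun j : Fin n => η (n - 1 - (j : ℕ))) = ∏ k ∈ Finset.range n, gaugeR q r k := by
  induction n generalizing q r η with
  | zero => rw [wronskian, Matrix.det_fin_zero, Finset.range_zero, Finset.prod_empty]
  | succ n ih =>
    have hu : IsUnit r := hunit 0 (by omega)
    have hinv := mul_inv_of_isUnit hu
    have hshift : ∀ k, gaugeR q r (k + 1) = gaugeR r⁻¹ (nextR q r) k := fun k => by
      rw [gaugeR, gaugeQR_succ_eq, gaugeQR_succ (k := 0) hu]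
      rfl
    let ζ : ℕ → Fn K := fun k => -r * pd 1 (r⁻¹ * η (k + 1))
    have hζ : ∀ k, k + 1 < n → IsLaxAdjValue r⁻¹ (nextR q r) (ζ k) (ζ (k + 1)) :=
      fun k hk => (hη (k + 1) (by omega)).gauge hu
    have key : wronskian (fun j : Fin n => ζ (n - 1 - (j : ℕ))) =
        ∏ k ∈ Finset.range n, gaugeR r⁻¹ (nextR q r) k := by
      -- For length zero the value `η 1` is unconstrained, so the new chain need not start at `nextR
      -- q r`.
      cases n with
      | zero => rw [wronskian, Matrix.det_fin_zero, Finset.range_zero, Finset.prod_empty]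
      | succ n =>
        refine ih _ _ ζ (fun k hk => hshift k ▸ hunit (k + 1) (by omega)) ?_ hζ
        obtain ⟨φ, hφ, h1⟩ := hη 0 (by omega)
        have e2 : r⁻¹ * (-pd 1 r - r * φ) = r * pd 1 r⁻¹ - φ := by
          linear_combination -φ * hinv - pd_inv hu 1
        have e4 : r * (r * pd 1 r⁻¹) = -pd 1 r := by
          linear_combination r * pd_inv hu 1 - pd 1 r * hinv
        have e5 := congrArg (pd 1) e4
        simp only [pd_mul, pd_neg] at e5
        simp only [ζ]
        rw [h1, h0, e2, pd_sub, hφ, h0, pd_mul, nextR]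
        linear_combination -e5
    have hη' : (fun j : Fin (n + 1) => η (n + 1 - 1 - (j : ℕ))) =
        fun j : Fin (n + 1) => r * (r⁻¹ * η (n - (j : ℕ))) := by
      funext j
      rw [← mul_assoc, hinv, one_mul, Nat.add_sub_cancel]
    have hζ' : (fun j : Fin n => ζ (n - 1 - (j : ℕ))) =
        fun j : Fin n => -r * pd 1 (r⁻¹ * η (n - (j : ℕ))) := by
      funext j
      simp only [ζ]
      rw [show n - 1 - (j : ℕ) + 1 = n - (j : ℕ) by omega]
    rw [hζ', wronskian_mul] at key
    rw [hη', wronskian_mul, wronskian_last_one _ (by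
      rw [Fin.val_last, Nat.sub_self, h0, mul_comm, hinv]), Finset.prod_range_succ', gaugeR_zero]
    simp only [hshift]
    -- The sign in `(-r)^n` matches the one from expanding along the last column, and the remaining
    -- power of `r` is the factor `r^{(0)}`.
    rw [← key, neg_pow]
    simp only [Fin.val_castSucc]
    ring

end CKP

end

open CKP in
theorem proposition2 {K : Type*} [Field K] [CharZero K] (c : ℕ+ →₀ K)
    (q r τ : CKP.Fn K) (W V : CKP.PDO K)
    (hsol : CKP.IsSolution q r W V τ)
    (hL : CKP.addFlowLax c W V q r = CKP.PDO.ofFn 0)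
    (hr : CKP.addFlowAdj c W V r = 0)
    (n : ℕ) (hunit : ∀ k < n, IsUnit (CKP.gaugeR q r k)) :
    (∀ k < n, CKP.gaugeLax q r (k + 1) =
      CKP.gaugeI (CKP.gaugeR q r k) * CKP.gaugeLax q r k *
        CKP.gaugeIInv (CKP.gaugeR q r k)) ∧
    (-CKP.stringD c (CKP.gaugeTau q r τ n * τ⁻¹) +
      (n : CKP.Fn K) * CKP.time c 1 * (CKP.gaugeTau q r τ n * τ⁻¹) = 0) ∧
    ∀ η : ℕ → CKP.Fn K, η 0 = r →
      (∀ k, k + 1 < n → CKP.IsLaxAdjValue q r (η k) (η (k + 1))) →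
      CKP.gaugeTau q r τ n =
        CKP.wronskian (fun j : Fin n => η (n - 1 - (j : ℕ))) * τ ∧
      -CKP.stringD c (CKP.wronskian fun j : Fin n => η (n - 1 - (j : ℕ))) +
        (n : CKP.Fn K) * CKP.time c 1 *
          CKP.wronskian (fun j : Fin n => η (n - 1 - (j : ℕ))) = 0 := by
  have hS : -stringD c (∏ k ∈ Finset.range n, gaugeR q r k) +
      (n : Fn K) * time c 1 * ∏ k ∈ Finset.range n, gaugeR q r k = 0 := by
    -- The weight of `q` needs `r` invertible, which is given only for `n ≥ 1`; for `n = 0` the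
    -- product is `1`.
    cases n with
    | zero => simp
    | succ n =>
      rw [stringD_prod_gaugeR (hsol.stringD_left hL hr (hunit 0 (by omega)))
        (hsol.stringD_right hr) _ hunit, neg_add_cancel]
  refine ⟨fun k hk => ?_, ?_, fun η h0 hη => ?_⟩
  · rw [gaugeLax, gaugeQR_succ (hunit k hk)]
    exact lax_gauge (hunit k hk)
  · rwa [gaugeTau_eq_prod, mul_assoc, mul_inv_of_isUnit hsol.tau.1, mul_one]
  · rw [wronskian_eq_prod_gaugeR n q r η hunit h0 hη]
    exact ⟨gaugeTau_eq_prod q r τ n, hS⟩
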